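/- All Lie algebras are real and finite-dimensional and carry their unique Hausdorff vector space topology. A \emph{Lie quasi-state} on $\mathfrak g$ is a function $\zeta:\mathfrak g\to\mathbb R$ with $\zeta(aX+bY)=a\zeta(X)+b\zeta(Y)$ for all $a,b\in\mathbb R$ and all $X,Y\in\mathfrak g$ with $[X,Y]=0$; it is \emph{$\mathrm{Ad}$-invariant} if $\zeta(\exp(\mathrm{ad}\,X)Y)=\zeta(Y)$ for all $X,Y\in\mathfrak g$. Let $\mathcal Q_{\mathrm{Ad}}(\mathfrak g)$ be the vector space of continuous $\mathrm{Ad}$-invariant Lie quasi-states on $\mathfrak g$. A homogeneous quasimorphism on a Lie group $G$ is a continuous function $f:G\to\mathbb R$ with $\sup_{g,h\in G}|f(gh)-f(g)-f(h)|<\infty$ and $f(g^n)=nf(g)$ for all $g\in G$, $n\in\mathbb Z$. Let $\mathcal Q_{\mathrm{qm}}(\mathfrak g)$ be the set of continuous Lie quasi-states on $\mathfrak g$ of the form $X\mapsto f(\exp_G X)$, where $f$ is a homogeneous quasimorphism on some Lie group $G$ with Lie algebra $\mathfrak g$. The Lie algebra $\mathfrak g$ is \emph{quasi-state rigid} if $\mathcal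 Q_{\mathrm{qm}}(\mathfrak g)=\mathcal Q_{\mathrm{Ad}}(\mathfrak g)$. Let $\mathfrak h_3$ be the three-dimensional Heisenberg algebra of strictly upper triangular real $3\times 3$ matrices. \textbf{Theorem.} Let $\mathfrak g=V\rtimes_\phi\mathbb R$ be a Lie algebra which splits over a codimension-one abelian ideal $V$; that is, $\mathfrak g=V\oplus\mathbb R X$ as a vector space with $X\neq 0$, and $\phi=\mathrm{ad}(X)|_V\in\mathrm{End}(V)$. Then $\mathfrak g$ is quasi-state rigid if and only if it does not surject onto $\mathfrak h_3$ (that is, if and only if there is no surjective Lie algebra homomorphism $\mathfrak g\to\mathfrak h_3$). More precisely, the following are equivalent: \begin{enumerate} \item[(i)] $\mathfrak g$ is not quasi-state rigid. \item[(ii)] $\mathcal Q_{\mathrm{Ad}}(\mathfrak g)$ is infinite-dimensional. \item[(ii')] $\mathcal Q_{\mathrm{Ad}}(\mathfrak g)$ has uncountable dimension. \item[(iii)] $\operatorname{im}\phi^2\subsetneq\operatorname{im}\phi$. \item[(iv)] There is a $\phi$-invariant splitting $V=V_0\oplus V_1$ with $n:=\dim V_0\ge 2$ such that in a suitable basis of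 $V_0$ the restriction $\phi|_{V_0}$ is represented by the $n\times n$ matrix with entries $1$ on the superdiagonal and $0$ elsewhere. \item[(v)] $\mathfrak g$ surjects onto $\mathfrak h_3$. \end{enumerate} -/

import Mathlib

open scoped Manifold ContDiff

namespace QuasiState

section LieAlgebra

variable {g : Type*} [LieRing g] [LieAlgebra ℝ g]

/-- A Lie quasi-state: linear on pairs of commuting elements. -/
def IsLieQuasiState (ζ : g → ℝ) : Prop :=
  ∀ (a b : ℝ) (X Y : g), ⁅X, Y⁆ = 0 → ζ (a • X + b • Y) = a * ζ X + b * ζ Y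

/-- `Ad (exp X) Y = exp (ad X) Y = ∑ₖ (ad X)ᵏ Y / k!`. -/
noncomputable def expAd [TopologicalSpace g] (X Y : g) : g :=
  ∑' k : ℕ, ((k.factorial : ℝ)⁻¹) • ((LieAlgebra.ad ℝ g X) ^ k) Y

/-- Invariance under the adjoint group of `g`, i.e. under its generators `exp (ad X)`. -/
def IsAdInvariant [TopologicalSpace g] (ζ : g → ℝ) : Prop :=
  ∀ X Y : g, ζ (expAd X Y) = ζ Y

variable (g) in
/-- The space `𝒬_Ad(g)` of continuous `Ad`-invariant Lie quasi-states. -/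
def contAdQuasiStates [TopologicalSpace g] : Submodule ℝ (g → ℝ) where
  carrier := {ζ | IsLieQuasiState ζ ∧ Continuous ζ ∧ IsAdInvariant ζ}
  zero_mem' := ⟨fun a b X Y _ => by simp, continuous_const, fun _ _ => rfl⟩
  add_mem' := by
    rintro ζ η ⟨h1, h2, h3⟩ ⟨k1, k2, k3⟩
    refine ⟨fun a b X Y h => ?_, h2.add k2, fun X Y => ?_⟩
    · simp only [Pi.add_apply, h1 a b X Y h, k1 a b X Y h]
      ring
    · simp only [Pi.add_apply, h3 X Y, k3 X Y]
  smul_mem' := by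
    rintro r ζ ⟨h1, h2, h3⟩
    refine ⟨fun a b X Y h => ?_, h2.const_smul r, fun X Y => ?_⟩
    · simp only [Pi.smul_apply, smul_eq_mul, h1 a b X Y h]
      ring
    · simp only [Pi.smul_apply, h3 X Y]

end LieAlgebra

/-- A homogeneous (continuous) quasimorphism. -/
structure IsHomogeneousQuasimorphism {G : Type*} [Group G] [TopologicalSpace G]
    (f : G → ℝ) : Prop where
  continuous : Continuous f
  bounded_defect : ∃ D : ℝ, ∀ x y : G, |f (x * y) - f x - f y| ≤ D
  homogeneous : ∀ (x : G) (n : ℤ), f (x ^ n) = n * f x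

/-- A smooth real Lie group is `C^k` for the order `k` over which Mathlib builds its Lie algebra. -/
instance : ENat.LEInfty (minSmoothness ℝ 3) := ⟨by
  rw [minSmoothness_of_isRCLikeNormedField]; exact ENat.LEInfty.out⟩

/-- `IsLieExp X x` says that `x = exp_G X`: the integral curve through `1` of the left-invariant
vector field of `X` is at `x` at time `1`. -/
def IsLieExp {E : Type*} [NormedAddCommGroup E] [NormedSpace ℝ E] {G : Type*}
    [TopologicalSpace G] [ChartedSpace E G] [Group G]
    (X : GroupLieAlgebra 𝓘(ℝ, E) G) (x : G) : Prop :=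
  ∃ γ : ℝ → G, γ 0 = 1 ∧ IsMIntegralCurve γ (mulInvariantVectorField X) ∧ γ 1 = x

/-- The set `𝒬_qm(g)` of continuous Lie quasi-states on `g` which are directional derivatives
`X ↦ f (exp_G X)` of homogeneous quasimorphisms `f` on some (Hausdorff, second countable) smooth Lie
group `G` with Lie algebra `g`. -/
def qmQuasiStates (g : Type*) [LieRing g] [LieAlgebra ℝ g] [TopologicalSpace g] : Set (g → ℝ) :=
  {ζ | IsLieQuasiState ζ ∧ Continuous ζ ∧
    ∃ (E : Type) (_ : NormedAddCommGroup E) (_ : NormedSpace ℝ E) (_ : FiniteDimensional ℝ E)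
      (G : Type) (_ : TopologicalSpace G) (_ : T2Space G) (_ : SecondCountableTopology G)
      (_ : ChartedSpace E G) (_ : Group G) (_ : LieGroup 𝓘(ℝ, E) ∞ G)
      (e : g ≃ₗ⁅ℝ⁆ GroupLieAlgebra 𝓘(ℝ, E) G) (f : G → ℝ),
      IsHomogeneousQuasimorphism f ∧ ∀ X : g, ∃ x : G, IsLieExp (e X) x ∧ ζ X = f x}

/-- Quasi-state rigidity: `𝒬_qm(g) = 𝒬_Ad(g)`. -/
def IsRigid (g : Type*) [LieRing g] [LieAlgebra ℝ g] [TopologicalSpace g] : Prop :=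
  qmQuasiStates g = (contAdQuasiStates g : Set (g → ℝ))

section Heisenberg

attribute [local instance] LieRing.ofAssociativeRing

/-- The three-dimensional Heisenberg algebra: strictly upper triangular real `3 × 3` matrices with
the commutator bracket. -/
def heisenberg : LieSubalgebra ℝ (Matrix (Fin 3) (Fin 3) ℝ) where
  carrier := {A | ∀ i j, j ≤ i → A i j = 0}
  zero_mem' := fun _ _ _ => rfl
  add_mem' := by
    intro A B hA hB i j h
    simp [hA i j h, hB i j h]
  smul_mem' := by
    intro r A hA i j h
    simp [hA i j h]
  lie_mem' := by
    intro A B hA hB i j h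
    have key : ∀ C D : Matrix (Fin 3) (Fin 3) ℝ, (∀ i j, j ≤ i → C i j = 0) →
        (∀ i j, j ≤ i → D i j = 0) → (C * D) i j = 0 := by
      intro C D hC hD
      rw [Matrix.mul_apply]
      refine Finset.sum_eq_zero fun k _ => ?_
      rcases le_total k i with hk | hk
      · simp [hC i k hk]
      · simp [hD k j (h.trans hk)]
    rw [Ring.lie_def, Matrix.sub_apply, key A B hA hB, key B A hB hA, sub_zero]

/-- `g` surjects onto the Heisenberg algebra. -/
def SurjectsOntoHeisenberg (g : Type*) [LieRing g] [LieAlgebra ℝ g] : Prop :=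
  ∃ p : g →ₗ⁅ℝ⁆ heisenberg, Function.Surjective p

end Heisenberg

/-- `φ` has a nilpotent Jordan block of size at least two: there is a `φ`-invariant splitting
`V = V₀ ⊕ V₁` with `n = dim V₀ ≥ 2` such that in some basis of `V₀` the restriction of `φ` is given
by the matrix with ones on the superdiagonal and zeros elsewhere. -/
def HasNilpotentJordanBlock {V : Type*} [AddCommGroup V] [Module ℝ V] (φ : Module.End ℝ V) :
    Prop :=
  ∃ (V₀ V₁ : Submodule ℝ V) (h₀ : ∀ v ∈ V₀, φ v ∈ V₀) (_ : ∀ v ∈ V₁, φ v ∈ V₁)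
    (_ : IsCompl V₀ V₁) (n : ℕ) (_ : 2 ≤ n) (b : Module.Basis (Fin n) ℝ V₀),
    LinearMap.toMatrix b b (φ.restrict h₀) =
      Matrix.of fun i j : Fin n => if (i : ℕ) + 1 = (j : ℕ) then (1 : ℝ) else 0

end QuasiState

/-! Everything turns on whether `im φ² = im φ`.

Suppose `im φ² ≠ im φ`. Then `φ` has a nilpotent Jordan block of size at least two. Its last two
coordinates are functionals `β ≠ 0` and `γ` with `β ∘ φ = 0` and `γ ∘ φ = β`. So `v + tX ↦ (t, β v,
γ v)` is a homomorphism onto the Heisenberg algebra. Applying `γ` to `[v + tX, w + sX] = tφw - sφv =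
0` gives `tβ(w) = sβ(v)`: commuting elements have collinear images in the `(t, β)`-plane. Hence
every continuous function of `(t, β)` that is linear on lines is a quasi-state. It is `Ad`-invariant
because `t` and `β` vanish on brackets. The functions `q³ / (aq² + t²)`, `a > 0`, give continuum
many independent ones (`IsSplit.aleph0_lt_rank`).

They do not all come from quasimorphisms. If `ad (X + w)` and `ad X` have the same powers on `v`,
then `exp n(X+v+w) = exp n(X+v) · exp(nX)⁻¹ · exp n(X+w)`. A homogeneous quasimorphism is additive
on this product up to a bound independent of `n`, so `ζ(X+v+w) + ζ(X) = ζ(X+v) + ζ(X+w)`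
(`affine_of_mem_qm`). The function with `a = 1` violates this for `v = w ∈ V`. The argument needs
`Ad (exp X) = exp (ad X)` for an arbitrary Lie group, which is what the manifold computations
supply.

Suppose `im φ² = im φ`, so that `V = ker φ + im φ`. Invariance under `exp (ad u)`, `u ∈ V`, makes
`ζ(v + tX)` independent of `v` modulo `im φ` when `t ≠ 0`; continuity then makes `ζ` vanish on `im
φ`, and `ker φ` commutes with `X`. So `ζ` is linear (`IsSplit.exists_linear`), the space is
finite-dimensional, and `ζ` integrates to a homomorphism on `V ⋊ ℝ`: the algebra is rigid. It has no
Heisenberg quotient, since a homomorphism to a two-step nilpotent algebra kills `im φ² = im φ = [g,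
g]`. -/

namespace QuasiState

/-! ### Logarithmic derivatives of curves in a Lie group. -/

section LieGroup

open VectorField

variable {E : Type*} [NormedAddCommGroup E] [NormedSpace ℝ E]
  {G : Type*} [TopologicalSpace G] [ChartedSpace E G] [Group G] [LieGroup 𝓘(ℝ, E) ∞ G]

variable (E) in
/-- The adjoint representation of a Lie group. -/
noncomputable def groupAd (g : G) : E →L[ℝ] E :=
  (mfderiv 𝓘(ℝ, E) 𝓘(ℝ, E) (fun h : G => g * h * g⁻¹) 1 :)

/-- The curve `γ` is differentiable at `s` with logarithmic derivative `X`. -/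
def HasLogDerivAt (γ : ℝ → G) (X : E) (s : ℝ) : Prop :=
  HasMFDerivAt 𝓘(ℝ, ℝ) 𝓘(ℝ, E) γ s
    ((1 : ℝ →L[ℝ] ℝ).smulRight
      (mulInvariantVectorField (I := 𝓘(ℝ, E)) (G := G) X (γ s)))

theorem mdifferentiable_mul_left (g : G) :
    MDifferentiable 𝓘(ℝ, E) 𝓘(ℝ, E) (fun h : G => g * h) :=
  (contMDiff_mul_left (I := 𝓘(ℝ, E)) (n := ∞)).mdifferentiable (by simp)

theorem mdifferentiable_mul_right (g : G) :
    MDifferentiable 𝓘(ℝ, E) 𝓘(ℝ, E) (fun h : G => h * g) :=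
  (contMDiff_mul_right (I := 𝓘(ℝ, E)) (n := ∞)).mdifferentiable (by simp)

theorem mdifferentiable_conj (g : G) :
    MDifferentiable 𝓘(ℝ, E) 𝓘(ℝ, E) (fun h : G => g * h * g⁻¹) :=
  (mdifferentiable_mul_right g⁻¹).comp (mdifferentiable_mul_left g)

omit [Group G] [LieGroup 𝓘(ℝ, E) ∞ G] in
theorem mfderiv_comp_model {f g : G → G} {x y : G} (hg : MDifferentiableAt 𝓘(ℝ, E) 𝓘(ℝ, E) g y)
    (hf : MDifferentiableAt 𝓘(ℝ, E) 𝓘(ℝ, E) f x) (hy : f x = y) :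
    (mfderiv 𝓘(ℝ, E) 𝓘(ℝ, E) (g ∘ f) x : E →L[ℝ] E) =
      (mfderiv 𝓘(ℝ, E) 𝓘(ℝ, E) g y : E →L[ℝ] E).comp
        (mfderiv 𝓘(ℝ, E) 𝓘(ℝ, E) f x : E →L[ℝ] E) := by
  subst hy
  exact mfderiv_comp x hg hf

theorem groupAd_mul (g h : G) : groupAd E (g * h) = (groupAd E g).comp (groupAd E h) := by
  have : (fun x : G => g * h * x * (g * h)⁻¹) =
      (fun x : G => g * x * g⁻¹) ∘ fun x : G => h * x * h⁻¹ := by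
    ext x; simp [mul_assoc]
  unfold groupAd
  rw [this]
  exact mfderiv_comp_model (y := (1 : G)) (mdifferentiable_conj g _) (mdifferentiable_conj h _)
    (by simp)

omit [LieGroup 𝓘(ℝ, E) ∞ G] in
theorem groupAd_one : groupAd E (1 : G) = ContinuousLinearMap.id ℝ E := by
  have : (fun x : G => 1 * x * (1 : G)⁻¹) = id := by ext x; simp
  unfold groupAd
  rw [this]
  exact mfderiv_id

theorem groupAd_inv_apply_self (g : G) (X : E) : groupAd E g⁻¹ (groupAd E g X) = X := by
  rw [← ContinuousLinearMap.comp_apply, ← groupAd_mul, inv_mul_cancel, groupAd_one]; rfl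

/-- Differentiate `g x h = (g h)(h⁻¹ x h)` in `x` at the identity. -/
theorem mfderiv_mul_right_mulInvariantVectorField (g h : G) (X : E) :
    (mfderiv 𝓘(ℝ, E) 𝓘(ℝ, E) (fun x : G => x * h) g (mulInvariantVectorField (I := 𝓘(ℝ, E)) (G := G) X g) : E) =
      mulInvariantVectorField (I := 𝓘(ℝ, E)) (G := G) (groupAd E h⁻¹ X) (g * h) := by
  have h1 : (mfderiv 𝓘(ℝ, E) 𝓘(ℝ, E) ((fun x : G => x * h) ∘ fun x => g * x) 1 : E →L[ℝ] E) =
      ((mfderiv 𝓘(ℝ, E) 𝓘(ℝ, E) (fun x : G => x * h) g : E →L[ℝ] E)).comp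
        (mfderiv 𝓘(ℝ, E) 𝓘(ℝ, E) (fun x : G => g * x) 1 : E →L[ℝ] E) :=
    mfderiv_comp_model (y := g) (mdifferentiable_mul_right h _) (mdifferentiable_mul_left g _) (by simp)
  have h2 : (mfderiv 𝓘(ℝ, E) 𝓘(ℝ, E) ((fun x : G => g * h * x) ∘ fun x => h⁻¹ * x * h⁻¹⁻¹) 1 :
      E →L[ℝ] E) =
      ((mfderiv 𝓘(ℝ, E) 𝓘(ℝ, E) (fun x : G => g * h * x) 1 : E →L[ℝ] E)).comp
        (mfderiv 𝓘(ℝ, E) 𝓘(ℝ, E) (fun x : G => h⁻¹ * x * h⁻¹⁻¹) 1 : E →L[ℝ] E) :=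
    mfderiv_comp_model (y := (1 : G)) (mdifferentiable_mul_left _ _) (mdifferentiable_conj _ _) (by simp)
  have h3 : ((fun x : G => x * h) ∘ fun x => g * x) =
      ((fun x : G => g * h * x) ∘ fun x => h⁻¹ * x * h⁻¹⁻¹) := by
    ext x; simp [mul_assoc]
  rw [h3] at h1
  have h4 := h1.symm.trans h2
  exact DFunLike.congr_fun h4 X

/-- Leibniz rule: left translation by `α s` preserves the field of `Y`, while right translation by
`β s` twists that of `X` by `Ad (β s)⁻¹`. -/
theorem HasLogDerivAt.mul {α β : ℝ → G} {X Y : E} {s : ℝ}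
    (hα : HasLogDerivAt α X s) (hβ : HasLogDerivAt β Y s) :
    HasLogDerivAt (fun t => α t * β t) (groupAd E (β s)⁻¹ X + Y) s := by
  have hm : MDifferentiableAt (𝓘(ℝ, E).prod 𝓘(ℝ, E)) 𝓘(ℝ, E) (fun p : G × G => p.1 * p.2)
      (α s, β s) := ((contMDiff_mul 𝓘(ℝ, E) ∞).mdifferentiable (by simp)) _
  have hp := HasMFDerivAt.prodMk hα hβ
  have hc := hm.hasMFDerivAt.comp s hp
  unfold HasLogDerivAt
  refine (hc : HasMFDerivAt 𝓘(ℝ, ℝ) 𝓘(ℝ, E) (fun t => α t * β t) s _).congr_mfderiv ?_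
  refine ContinuousLinearMap.ext_ring ?_
  have key := mfderiv_prod_eq_add_apply (I := 𝓘(ℝ, E)) (I' := 𝓘(ℝ, E)) (p := (α s, β s)) hm (v := (mulInvariantVectorField (I := 𝓘(ℝ, E)) (G := G) X (α s),
    mulInvariantVectorField (I := 𝓘(ℝ, E)) (G := G) Y (β s)))
  have e1 := mfderiv_mul_right_mulInvariantVectorField (α s) (β s) X
  have e2 : (mfderiv 𝓘(ℝ, E) 𝓘(ℝ, E) (fun x : G => α s * x) (β s)
      (mulInvariantVectorField (I := 𝓘(ℝ, E)) (G := G) Y (β s)) : E) = mulInvariantVectorField (I := 𝓘(ℝ, E)) (G := G) Y (α s * β s) := by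
    have h1 : (mfderiv 𝓘(ℝ, E) 𝓘(ℝ, E) ((fun x : G => α s * x) ∘ fun x => β s * x) 1 :
        E →L[ℝ] E) = ((mfderiv 𝓘(ℝ, E) 𝓘(ℝ, E) (fun x : G => α s * x) (β s) : E →L[ℝ] E)).comp
          (mfderiv 𝓘(ℝ, E) 𝓘(ℝ, E) (fun x : G => β s * x) 1 : E →L[ℝ] E) :=
      mfderiv_comp_model (y := β s) (mdifferentiable_mul_left _ _) (mdifferentiable_mul_left _ _) (by simp)
    have h3 : ((fun x : G => α s * x) ∘ fun x => β s * x) = fun x => α s * β s * x := by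
      ext x; simp [mul_assoc]
    rw [h3] at h1
    exact (DFunLike.congr_fun h1 Y).symm
  have key' : (mfderiv (𝓘(ℝ, E).prod 𝓘(ℝ, E)) 𝓘(ℝ, E) (fun p : G × G => p.1 * p.2) (α s, β s)
      (mulInvariantVectorField (I := 𝓘(ℝ, E)) (G := G) X (α s), mulInvariantVectorField (I := 𝓘(ℝ, E)) (G := G) Y (β s)) : E) =
      mulInvariantVectorField (I := 𝓘(ℝ, E)) (G := G) (groupAd E (β s)⁻¹ X) (α s * β s) +
      mulInvariantVectorField (I := 𝓘(ℝ, E)) (G := G) Y (α s * β s) := by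
    rw [← e1, ← e2]; exact key
  have key2 := congrFun (mulInvariantVectorField_add (I := 𝓘(ℝ, E)) (G := G)
    (groupAd E (β s)⁻¹ X) Y) (α s * β s)
  have l : ∀ (T : E × E →L[ℝ] E) (a b : E), T (((1 : ℝ →L[ℝ] ℝ).smulRight a).prod
    ((1 : ℝ →L[ℝ] ℝ).smulRight b) 1) = T (a, b) := by intro T a b; simp
  have r : ∀ a : E, ((1 : ℝ →L[ℝ] ℝ).smulRight a) 1 = a := by intro a; simp
  exact (l _ _ _).trans (key'.trans (key2.symm.trans (r _).symm))

theorem integralCurve_unique [T2Space G] {α β : ℝ → G} {X : E}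
    (hα : ∀ s, HasLogDerivAt α X s) (hβ : ∀ s, HasLogDerivAt β X s) {s : ℝ} (h : α s = β s) :
    α = β := by
  have : IsManifold 𝓘(ℝ, E) 1 G := IsManifold.of_le (m := 1) (n := ∞) (by simp)
  refine isMIntegralCurve_Ioo_eq_of_contMDiff_boundaryless (I := 𝓘(ℝ, E)) (t₀ := s)
    ((contMDiff_mulInvariantVectorField (I := 𝓘(ℝ, E)) (G := G) X).of_le ?_) hα hβ h
  rw [minSmoothness_of_isRCLikeNormedField]; norm_num

end LieGroup
-- The multiplication and `Ad` in a chart at the identity.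
section LieGroup

open VectorField Set Filter
open scoped Topology

variable {E : Type*} [NormedAddCommGroup E] [NormedSpace ℝ E]
  {G : Type*} [TopologicalSpace G] [ChartedSpace E G] [Group G] [LieGroup 𝓘(ℝ, E) ∞ G]

variable (E G) in
/-- The multiplication of a Lie group in the preferred chart at the identity. -/
noncomputable def chartMul (p : E × E) : E :=
  extChartAt 𝓘(ℝ, E) (1 : G) ((extChartAt 𝓘(ℝ, E) (1 : G)).symm p.1 *
    (extChartAt 𝓘(ℝ, E) (1 : G)).symm p.2)

variable (E G) in
/-- The coordinates of the identity of a Lie group. -/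
noncomputable def chartOne : E := extChartAt 𝓘(ℝ, E) (1 : G) (1 : G)

omit [LieGroup 𝓘(ℝ, E) ∞ G] in
theorem symm_chartOne : (extChartAt 𝓘(ℝ, E) (1 : G)).symm (chartOne E G) = 1 :=
  extChartAt_to_inv (I := 𝓘(ℝ, E)) 1

theorem isManifold_of_lieGroup : IsManifold 𝓘(ℝ, E) ∞ G :=
  LieGroup.toContMDiffMul.toIsManifold

theorem isManifold_one_of_lieGroup : IsManifold 𝓘(ℝ, E) 1 G :=
  have : IsManifold 𝓘(ℝ, E) ∞ G := isManifold_of_lieGroup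
  IsManifold.of_le (m := 1) (n := ∞) (by simp)

theorem contDiffAt_chartMul {n : ℕ} :
    ContDiffAt ℝ n (chartMul E G) (chartOne E G, chartOne E G) := by
  have : IsManifold 𝓘(ℝ, E) ∞ G := isManifold_of_lieGroup
  have hs : ContMDiffAt 𝓘(ℝ, E) 𝓘(ℝ, E) ∞ (extChartAt 𝓘(ℝ, E) (1 : G)).symm (chartOne E G) :=
    (contMDiffOn_extChartAt_symm (I := 𝓘(ℝ, E)) (n := ∞) (1 : G)).contMDiffAt
      (extChartAt_target_mem_nhds (I := 𝓘(ℝ, E)) (1 : G))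
  have h1 : ContMDiffAt 𝓘(ℝ, E × E) 𝓘(ℝ, E) ∞
      (fun p : E × E => (extChartAt 𝓘(ℝ, E) (1 : G)).symm p.1) (chartOne E G, chartOne E G) :=
    ContMDiffAt.comp (x := (chartOne E G, chartOne E G)) (g := (extChartAt 𝓘(ℝ, E) (1 : G)).symm)
      (f := Prod.fst) hs contDiff_fst.contDiffAt.contMDiffAt
  have h2 : ContMDiffAt 𝓘(ℝ, E × E) 𝓘(ℝ, E) ∞
      (fun p : E × E => (extChartAt 𝓘(ℝ, E) (1 : G)).symm p.2) (chartOne E G, chartOne E G) :=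
    ContMDiffAt.comp (x := (chartOne E G, chartOne E G)) (g := (extChartAt 𝓘(ℝ, E) (1 : G)).symm)
      (f := Prod.snd) hs contDiff_snd.contDiffAt.contMDiffAt
  have h3 := h1.mul h2
  have h4 : ContMDiffAt 𝓘(ℝ, E) 𝓘(ℝ, E) ∞ (extChartAt 𝓘(ℝ, E) (1 : G))
      ((extChartAt 𝓘(ℝ, E) (1 : G)).symm (chartOne E G) *
        (extChartAt 𝓘(ℝ, E) (1 : G)).symm (chartOne E G)) := by
    rw [symm_chartOne, one_mul]
    exact contMDiffAt_extChartAt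
  have h5 := ContMDiffAt.comp (x := (chartOne E G, chartOne E G))
    (g := extChartAt 𝓘(ℝ, E) (1 : G)) h4 h3
  exact (contMDiffAt_iff_contDiffAt.mp h5).of_le (by exact_mod_cast le_top)

omit [Group G] [LieGroup 𝓘(ℝ, E) ∞ G] in
theorem mfderiv_extChartAt_symm_self [IsManifold 𝓘(ℝ, E) 1 G] (x : G) :
    (mfderiv 𝓘(ℝ, E) 𝓘(ℝ, E) (extChartAt 𝓘(ℝ, E) x).symm (extChartAt 𝓘(ℝ, E) x x) : E →L[ℝ] E) =
      ContinuousLinearMap.id ℝ E := by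
  rw [← mfderivWithin_univ]
  have := mfderivWithin_range_extChartAt_symm (I := 𝓘(ℝ, E)) (x := x)
  simpa using! this

omit [Group G] [LieGroup 𝓘(ℝ, E) ∞ G] in
/-- The derivative at the base point of a map written in a chart. -/
theorem fderiv_extChartAt_comp [IsManifold 𝓘(ℝ, E) 1 G] {f : G → G} {x : G}
    (hf : MDifferentiableAt 𝓘(ℝ, E) 𝓘(ℝ, E) f x) {y : G} (hy : f x = y)
    (hs : y ∈ (extChartAt 𝓘(ℝ, E) x).source) (Y : E) :
    fderiv ℝ (fun z => extChartAt 𝓘(ℝ, E) x (f ((extChartAt 𝓘(ℝ, E) x).symm z)))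
      (extChartAt 𝓘(ℝ, E) x x) Y =
    (mfderiv 𝓘(ℝ, E) 𝓘(ℝ, E) (extChartAt 𝓘(ℝ, E) x) y : E →L[ℝ] E)
      ((mfderiv 𝓘(ℝ, E) 𝓘(ℝ, E) f x : E →L[ℝ] E) Y) := by
  subst hy
  have hsymm : MDifferentiableAt 𝓘(ℝ, E) 𝓘(ℝ, E) (extChartAt 𝓘(ℝ, E) x).symm
      (extChartAt 𝓘(ℝ, E) x x) :=
    (mdifferentiableOn_extChartAt_symm (I := 𝓘(ℝ, E)) (x := x)).mdifferentiableAt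
      (extChartAt_target_mem_nhds (I := 𝓘(ℝ, E)) x)
  have hχ : MDifferentiableAt 𝓘(ℝ, E) 𝓘(ℝ, E) (extChartAt 𝓘(ℝ, E) x) (f x) :=
    mdifferentiableAt_extChartAt (by rwa [extChartAt_source] at hs)
  have h0 : (extChartAt 𝓘(ℝ, E) x).symm (extChartAt 𝓘(ℝ, E) x x) = x := extChartAt_to_inv x
  have h1 := mfderiv_comp_of_eq (x := extChartAt 𝓘(ℝ, E) x x) (y := x)
    (hχ.comp x hf) hsymm h0
  have h2 := mfderiv_comp x hχ hf
  rw [← mfderiv_eq_fderiv]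
  have h3 := DFunLike.congr_fun h1 Y
  have h4 : (mfderiv 𝓘(ℝ, E) 𝓘(ℝ, E) (extChartAt 𝓘(ℝ, E) x).symm (extChartAt 𝓘(ℝ, E) x x) :
    E →L[ℝ] E) Y = Y := by rw [mfderiv_extChartAt_symm_self]; rfl
  refine h3.trans ?_
  have h5 : (mfderiv 𝓘(ℝ, E) 𝓘(ℝ, E) (extChartAt 𝓘(ℝ, E) x ∘ f) 
     ((extChartAt 𝓘(ℝ, E) x).symm (extChartAt 𝓘(ℝ, E) x x)) : E →L[ℝ] E) = 
     (mfderiv 𝓘(ℝ, E) 𝓘(ℝ, E) (extChartAt 𝓘(ℝ, E) x ∘ f) x : E →L[ℝ] E) := by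
    rw [h0]
  refine (DFunLike.congr_fun h5 _).trans ?_
  refine (congrArg (mfderiv 𝓘(ℝ, E) 𝓘(ℝ, E) (extChartAt 𝓘(ℝ, E) x ∘ f) x : E →L[ℝ] E) h4).trans ?_
  exact DFunLike.congr_fun h2 Y

theorem eventually_differentiableAt_chartMul :
    ∀ᶠ p in 𝓝 (chartOne E G, chartOne E G), DifferentiableAt ℝ (chartMul E G) p := by
  filter_upwards [(contDiffAt_chartMul (G := G) (n := 1)).eventually (by simp)] with p hp
  exact hp.differentiableAt (by simp)

theorem fderiv_chartMul_right {x : E} (hx : x ∈ (extChartAt 𝓘(ℝ, E) (1 : G)).target)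
    (hd : DifferentiableAt ℝ (chartMul E G) (x, chartOne E G)) (Y : E) :
    fderiv ℝ (chartMul E G) (x, chartOne E G) (0, Y) =
      (mfderiv 𝓘(ℝ, E) 𝓘(ℝ, E) (extChartAt 𝓘(ℝ, E) (1 : G))
        ((extChartAt 𝓘(ℝ, E) (1 : G)).symm x) : E →L[ℝ] E)
      ((mfderiv 𝓘(ℝ, E) 𝓘(ℝ, E) (fun h : G => (extChartAt 𝓘(ℝ, E) (1 : G)).symm x * h) 1 :
        E →L[ℝ] E) Y) := by
  have := isManifold_one_of_lieGroup (E := E) (G := G)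
  rw [← fderiv_extChartAt_comp (mdifferentiable_mul_left _ _) (mul_one _)
    ((extChartAt 𝓘(ℝ, E) (1 : G)).map_target hx)]
  have h := hd.hasFDerivAt.comp (chartOne E G) (hasFDerivAt_prodMk_right x (chartOne E G))
  have h' : HasFDerivAt (fun z => extChartAt 𝓘(ℝ, E) (1 : G)
    ((extChartAt 𝓘(ℝ, E) (1 : G)).symm x * (extChartAt 𝓘(ℝ, E) (1 : G)).symm z)) _
    (extChartAt 𝓘(ℝ, E) (1 : G) 1) := h
  rw [h'.fderiv]
  simp

theorem fderiv_chartMul_left {x : E} (hx : x ∈ (extChartAt 𝓘(ℝ, E) (1 : G)).target)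
    (hd : DifferentiableAt ℝ (chartMul E G) (chartOne E G, x)) (Y : E) :
    fderiv ℝ (chartMul E G) (chartOne E G, x) (Y, 0) =
      (mfderiv 𝓘(ℝ, E) 𝓘(ℝ, E) (extChartAt 𝓘(ℝ, E) (1 : G))
        ((extChartAt 𝓘(ℝ, E) (1 : G)).symm x) : E →L[ℝ] E)
      ((mfderiv 𝓘(ℝ, E) 𝓘(ℝ, E) (fun h : G => h * (extChartAt 𝓘(ℝ, E) (1 : G)).symm x) 1 :
        E →L[ℝ] E) Y) := by
  have := isManifold_one_of_lieGroup (E := E) (G := G)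
  rw [← fderiv_extChartAt_comp (mdifferentiable_mul_right _ _) (one_mul _)
    ((extChartAt 𝓘(ℝ, E) (1 : G)).map_target hx)]
  have h := HasFDerivAt.comp (f := fun e => (e, x)) (chartOne E G) hd.hasFDerivAt
    (hasFDerivAt_prodMk_left (𝕜 := ℝ) (chartOne E G) x)
  have h' : HasFDerivAt (fun z => extChartAt 𝓘(ℝ, E) (1 : G)
    ((extChartAt 𝓘(ℝ, E) (1 : G)).symm z * (extChartAt 𝓘(ℝ, E) (1 : G)).symm x)) _
    (extChartAt 𝓘(ℝ, E) (1 : G) 1) := h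
  rw [h'.fderiv]
  simp

theorem mfderiv_mul_left_eq_groupAd (g : G) (Y : E) :
    (mfderiv 𝓘(ℝ, E) 𝓘(ℝ, E) (fun h : G => g * h) 1 : E →L[ℝ] E) Y =
      (mfderiv 𝓘(ℝ, E) 𝓘(ℝ, E) (fun h : G => h * g) 1 : E →L[ℝ] E) (groupAd E g Y) := by
  have h : (fun h : G => g * h) = (fun h : G => h * g) ∘ fun h : G => g * h * g⁻¹ := by
    ext; simp
  have h1 := mfderiv_comp_model (x := (1 : G)) (y := (1 : G)) (mdifferentiable_mul_right (E := E) g _)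
    (mdifferentiable_conj g _) (by simp)
  rw [← h] at h1
  exact DFunLike.congr_fun h1 Y

/-- Since `g h = (g h g⁻¹) g`, near the identity `Ad` is a quotient of the two partial derivatives
of the multiplication. In this form it can be differentiated. -/
theorem fderiv_chartMul_eq_groupAd :
    ∀ᶠ x in 𝓝 (chartOne E G), ∀ Y : E, fderiv ℝ (chartMul E G) (x, chartOne E G) (0, Y) =
      fderiv ℝ (chartMul E G) (chartOne E G, x)
        (groupAd E ((extChartAt 𝓘(ℝ, E) (1 : G)).symm x) Y, 0) := by
  have hd := eventually_differentiableAt_chartMul (E := E) (G := G)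
  have c1 : Tendsto (fun x : E => (x, chartOne E G)) (𝓝 (chartOne E G))
      (𝓝 (chartOne E G, chartOne E G)) := Continuous.tendsto (by fun_prop) _
  have c2 : Tendsto (fun x : E => (chartOne E G, x)) (𝓝 (chartOne E G))
      (𝓝 (chartOne E G, chartOne E G)) := Continuous.tendsto (by fun_prop) _
  filter_upwards [c1.eventually hd, c2.eventually hd,
    extChartAt_target_mem_nhds (I := 𝓘(ℝ, E)) (1 : G)] with x h1 h2 hx Y
  rw [fderiv_chartMul_right hx h1, fderiv_chartMul_left hx h2, mfderiv_mul_left_eq_groupAd]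

end LieGroup
-- The derivative of `Ad` is the bracket.
section LieGroup

open VectorField Set Filter
open scoped Topology

variable {E : Type*} [NormedAddCommGroup E] [NormedSpace ℝ E]
  {G : Type*} [TopologicalSpace G] [ChartedSpace E G] [Group G] [LieGroup 𝓘(ℝ, E) ∞ G]

variable (E G) in
/-- The second derivative at the identity of the multiplication in the preferred chart. -/
noncomputable def chartMulSnd : (E × E) →L[ℝ] (E × E) →L[ℝ] E :=
  fderiv ℝ (fderiv ℝ (chartMul E G)) (chartOne E G, chartOne E G)

theorem hasFDerivAt_fderiv_chartMul :
    HasFDerivAt (fderiv ℝ (chartMul E G)) (chartMulSnd E G) (chartOne E G, chartOne E G) :=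
  (((contDiffAt_chartMul (n := 2)).fderiv_right (m := 1) (by norm_num)).differentiableAt
    (by simp)).hasFDerivAt

theorem chartMulSnd_symm (a b : E × E) : chartMulSnd E G a b = chartMulSnd E G b a :=
  (contDiffAt_chartMul (n := 2)).isSymmSndFDerivAt (by simp) a b

theorem mpullback_mulInvariantVectorField_chart (Y : E) :
    (mpullbackWithin 𝓘(ℝ, E) 𝓘(ℝ, E) (extChartAt 𝓘(ℝ, E) (1 : G)).symm
      (mulInvariantVectorField (I := 𝓘(ℝ, E)) (G := G) Y) (range 𝓘(ℝ, E)) : E → E)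
      =ᶠ[𝓝 (chartOne E G)] fun x => fderiv ℝ (chartMul E G) (x, chartOne E G) (0, Y) := by
  have := isManifold_one_of_lieGroup (E := E) (G := G)
  have hd := eventually_differentiableAt_chartMul (E := E) (G := G)
  have c1 : Tendsto (fun x : E => (x, chartOne E G)) (𝓝 (chartOne E G))
      (𝓝 (chartOne E G, chartOne E G)) := Continuous.tendsto (by fun_prop) _
  filter_upwards [c1.eventually hd,
    extChartAt_target_mem_nhds (I := 𝓘(ℝ, E)) (1 : G)] with x h1 hx
  rw [fderiv_chartMul_right hx h1]
  have h2 := ContinuousLinearMap.inverse_eq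
    (mfderivWithin_extChartAt_symm_comp_mfderiv_extChartAt (I := 𝓘(ℝ, E)) hx)
    (mfderiv_extChartAt_comp_mfderivWithin_extChartAt_symm hx)
  exact DFunLike.congr_fun h2 _

variable (G) in
/-- The Lie bracket of a Lie group, on the model space. -/
noncomputable def groupBracket (X Y : E) : E :=
  mlieBracket 𝓘(ℝ, E) (mulInvariantVectorField (I := 𝓘(ℝ, E)) (G := G) X)
    (mulInvariantVectorField (I := 𝓘(ℝ, E)) (G := G) Y) (1 : G)

/-- In the chart the left-invariant field of `Y` is the partial derivative `x ↦ ∂₂m(x, e) Y`, whose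
derivative at `e` is a mixed second derivative of the multiplication `m`. -/
theorem bracket_eq_chartMulSnd (X Y : E) :
    groupBracket G X Y =
      chartMulSnd E G (X, 0) (0, Y) - chartMulSnd E G (Y, 0) (0, X) := by
  have := isManifold_one_of_lieGroup (E := E) (G := G)
  have hfd : ∀ Y : E, HasFDerivAt (fun x => fderiv ℝ (chartMul E G) (x, chartOne E G) (0, Y))
      (((ContinuousLinearMap.apply ℝ E ((0 : E), Y)).comp (chartMulSnd E G)).comp
        (ContinuousLinearMap.inl ℝ E E)) (chartOne E G) := fun Y =>
    HasFDerivAt.comp (g := fun p => fderiv ℝ (chartMul E G) p (0, Y))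
      (f := fun x => (x, chartOne E G)) _
      ((ContinuousLinearMap.apply ℝ E ((0 : E), Y)).hasFDerivAt.comp _ hasFDerivAt_fderiv_chartMul)
      (hasFDerivAt_prodMk_left (𝕜 := ℝ) (chartOne E G) (chartOne E G))
  have hv : ∀ Y : E, fderiv ℝ (chartMul E G) (chartOne E G, chartOne E G) (0, Y) = Y := by
    intro Y
    rw [fderiv_chartMul_right (x := chartOne E G) (mem_extChartAt_target (I := 𝓘(ℝ, E)) (1 : G))
      eventually_differentiableAt_chartMul.self_of_nhds]
    have h1 : (extChartAt 𝓘(ℝ, E) (1 : G)).symm (chartOne E G) = 1 := symm_chartOne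
    rw [h1]
    have h2 : (fun h : G => 1 * h) = id := by ext; simp
    rw [h2, mfderiv_id, mfderiv_extChartAt_self]
    rfl
  have h1 : (lieBracket ℝ
      (mpullbackWithin 𝓘(ℝ, E) 𝓘(ℝ, E) (extChartAt 𝓘(ℝ, E) (1 : G)).symm
        (mulInvariantVectorField (I := 𝓘(ℝ, E)) (G := G) X) (range 𝓘(ℝ, E)) : E → E)
      (mpullbackWithin 𝓘(ℝ, E) 𝓘(ℝ, E) (extChartAt 𝓘(ℝ, E) (1 : G)).symm
        (mulInvariantVectorField (I := 𝓘(ℝ, E)) (G := G) Y) (range 𝓘(ℝ, E)) : E → E)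
        (chartOne E G)) =
      chartMulSnd E G (X, 0) (0, Y) - chartMulSnd E G (Y, 0) (0, X) := by
    rw [(mpullback_mulInvariantVectorField_chart X).lieBracket_vectorField_eq
      (mpullback_mulInvariantVectorField_chart Y)]
    rw [lieBracket, (hfd X).fderiv, (hfd Y).fderiv]
    simp only [hv]
    simp
  have hinv : ∀ T : E →L[ℝ] E, T = ContinuousLinearMap.id ℝ E → ∀ v, T.inverse v = v := by
    rintro T rfl v
    rw [ContinuousLinearMap.inverse_id]
    rfl
  have huniv : ∀ (V W : E → E) (s : Set E) (x : E), s = univ →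
      lieBracketWithin ℝ V W s x = lieBracket ℝ V W x := by
    rintro V W s x rfl
    rw [lieBracketWithin_univ]
  rw [← h1, groupBracket, mlieBracket, mlieBracketWithin_apply]
  exact (hinv _ mfderiv_extChartAt_self _).trans (huniv _ _ _ _ (by simp))

omit [LieGroup 𝓘(ℝ, E) ∞ G] in
/-- The logarithmic derivative of a curve through the identity is its velocity in the chart. -/
theorem HasLogDerivAt.hasDerivAt_chart {α : ℝ → G} {X : E} (h0 : α 0 = 1)
    (h : HasLogDerivAt α X 0) :
    HasDerivAt (fun s => extChartAt 𝓘(ℝ, E) (1 : G) (α s)) X 0 := by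
  have h1 := h.2
  have e : mulInvariantVectorField (I := 𝓘(ℝ, E)) (G := G) X (1 : G) = X := by
    have h2 : (fun h : G => 1 * h) = id := by ext; simp
    unfold mulInvariantVectorField
    rw [h2, mfderiv_id]
    rfl
  have e2 : (mulInvariantVectorField (I := 𝓘(ℝ, E)) (G := G) X (α 0) : E) = X := by
    rw [h0]; exact e
  have h3 : HasFDerivWithinAt (fun s => extChartAt 𝓘(ℝ, E) (α 0) (α s))
      ((1 : ℝ →L[ℝ] ℝ).smulRight (mulInvariantVectorField (I := 𝓘(ℝ, E)) (G := G) X (α 0) : E))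
      (range 𝓘(ℝ, ℝ)) (0 : ℝ) := h1
  rw [e2, h0] at h3
  have h4 := h3.hasFDerivAt (by simp)
  simpa using h4.hasDerivAt

/-- Near `s = 0`, `Ad (α s) Y = Q(s)⁻¹ P(s)` with `Q = ∂₁m` and `P = ∂₂m Y`. As `Q(0) = 1` and `P(0)
= Y`, the derivative is `P' - Q' Y`, and symmetry of the second derivative turns it into the
bracket. -/
theorem hasDerivAt_groupAd_zero [CompleteSpace E] {α : ℝ → G} {X : E} (h0 : α 0 = 1)
    (h : HasLogDerivAt α X 0) (Y : E) :
    HasDerivAt (fun s => groupAd E (α s) Y)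
      (groupBracket G X Y) 0 := by
  set x : ℝ → E := fun s => extChartAt 𝓘(ℝ, E) (1 : G) (α s) with hxdef
  have hx : HasDerivAt x X 0 := h.hasDerivAt_chart h0
  have hx0 : x 0 = chartOne E G := by simp [hxdef, h0, chartOne]
  have hP : HasDerivAt (fun s => fderiv ℝ (chartMul E G) (x s, chartOne E G) (0, Y))
      (chartMulSnd E G (X, 0) (0, Y)) 0 := by
    have h1 : HasDerivAt (fun s => (x s, chartOne E G)) (X, 0) 0 :=
      hx.prodMk (hasDerivAt_const _ _)
    have h2 : HasFDerivAt (fderiv ℝ (chartMul E G)) (chartMulSnd E G) (x 0, chartOne E G) := by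
      rw [hx0]; exact hasFDerivAt_fderiv_chartMul
    have h3 := HasFDerivAt.comp_hasDerivAt (f := fun s => (x s, chartOne E G)) (0 : ℝ) h2 h1
    simpa using h3.clm_apply (hasDerivAt_const 0 ((0 : E), Y))
  set Q : ℝ → E →L[ℝ] E := fun s =>
    (fderiv ℝ (chartMul E G) (chartOne E G, x s)).comp (ContinuousLinearMap.inl ℝ E E) with hQdef
  have hQ : HasDerivAt Q ((chartMulSnd E G (0, X)).comp (ContinuousLinearMap.inl ℝ E E)) 0 := by
    have h1 : HasDerivAt (fun s => (chartOne E G, x s)) (0, X) 0 :=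
      (hasDerivAt_const _ _).prodMk hx
    have h2 : HasFDerivAt (fderiv ℝ (chartMul E G)) (chartMulSnd E G) (chartOne E G, x 0) := by
      rw [hx0]; exact hasFDerivAt_fderiv_chartMul
    have h3 := HasFDerivAt.comp_hasDerivAt (f := fun s => (chartOne E G, x s)) (0 : ℝ) h2 h1
    simpa using h3.clm_comp (hasDerivAt_const 0 (ContinuousLinearMap.inl ℝ E E))
  have hQ0 : Q 0 = 1 := by
    ext Z
    simp only [hQdef, hx0, ContinuousLinearMap.comp_apply, ContinuousLinearMap.inl_apply]
    have := isManifold_one_of_lieGroup (E := E) (G := G)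
    rw [fderiv_chartMul_left (x := chartOne E G) (mem_extChartAt_target (I := 𝓘(ℝ, E)) (1 : G))
      eventually_differentiableAt_chartMul.self_of_nhds]
    have h1 : (extChartAt 𝓘(ℝ, E) (1 : G)).symm (chartOne E G) = 1 := symm_chartOne
    rw [h1]
    have h2 : (fun h : G => h * 1) = id := by ext; simp
    rw [h2, mfderiv_id, mfderiv_extChartAt_self]
    rfl
  have hinv : HasDerivAt (fun s => Ring.inverse (Q s))
      (-((chartMulSnd E G (0, X)).comp (ContinuousLinearMap.inl ℝ E E))) 0 := by
    have h1 := hasFDerivAt_ringInverse (𝕜 := ℝ) (1 : (E →L[ℝ] E)ˣ)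
    rw [Units.val_one, ← hQ0] at h1
    have h2 := h1.comp_hasDerivAt (0 : ℝ) hQ
    simpa [hQ0, ContinuousLinearMap.mul_def] using! h2
  have hu := hinv.clm_apply hP
  have hev : (fun s => groupAd E (α s) Y) =ᶠ[𝓝 0] fun s =>
      Ring.inverse (Q s) (fderiv ℝ (chartMul E G) (x s, chartOne E G) (0, Y)) := by
    have hαc : ContinuousAt α 0 := h.1
    have hxc : Tendsto x (𝓝 0) (𝓝 (chartOne E G)) := by rw [← hx0]; exact hx.continuousAt
    have hsrc : ∀ᶠ s in 𝓝 (0 : ℝ), α s ∈ (extChartAt 𝓘(ℝ, E) (1 : G)).source := by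
      refine hαc.eventually ?_
      rw [h0]
      exact extChartAt_source_mem_nhds (I := 𝓘(ℝ, E)) (1 : G)
    have hunit : ∀ᶠ s in 𝓝 (0 : ℝ), IsUnit (Q s) := by
      refine hQ.continuousAt.eventually ?_
      rw [hQ0]
      exact Units.isOpen.mem_nhds isUnit_one
    filter_upwards [hxc.eventually fderiv_chartMul_eq_groupAd, hsrc, hunit] with s h1 h2 h3
    rw [h1 Y]
    have h4 : (extChartAt 𝓘(ℝ, E) (1 : G)).symm (x s) = α s :=
      (extChartAt 𝓘(ℝ, E) (1 : G)).left_inv h2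
    rw [h4]
    have h5 := DFunLike.congr_fun (Ring.inverse_mul_cancel _ h3) (groupAd E (α s) Y)
    exact h5.symm
  refine (hu.congr_of_eventuallyEq hev).congr_deriv ?_
  rw [bracket_eq_chartMulSnd, chartMulSnd_symm (Y, 0) (0, X), hQ0]
  have h6 : fderiv ℝ (chartMul E G) (x 0, chartOne E G) (0, Y) = Y := by
    have := hev.self_of_nhds
    simp only [hQ0] at this
    simpa [h0, groupAd_one] using this.symm
  rw [h6]
  simp
  abel

end LieGroup
-- One-parameter subgroups and `Ad ∘ exp = exp ∘ ad`.
section LieGroup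

open VectorField Set Filter
open scoped Topology

variable {E : Type*} [NormedAddCommGroup E] [NormedSpace ℝ E]
  {G : Type*} [TopologicalSpace G] [ChartedSpace E G] [Group G] [LieGroup 𝓘(ℝ, E) ∞ G]

omit [LieGroup 𝓘(ℝ, E) ∞ G] in
theorem hasLogDerivAt_const (g : G) (s : ℝ) : HasLogDerivAt (fun _ => g) (0 : E) s := by
  have h : (mulInvariantVectorField (I := 𝓘(ℝ, E)) (G := G) (0 : E) g : E) = 0 :=
    map_zero (mfderiv 𝓘(ℝ, E) 𝓘(ℝ, E) (fun h : G => g * h) 1 : E →L[ℝ] E)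
  refine (hasMFDerivAt_const g s).congr_mfderiv ?_
  refine ContinuousLinearMap.ext_ring ?_
  have r : ∀ a : E, a = 0 → (0 : ℝ →L[ℝ] E) 1 = ((1 : ℝ →L[ℝ] ℝ).smulRight a) 1 := by
    rintro a rfl; simp
  exact r _ h

theorem HasLogDerivAt.const_mul {γ : ℝ → G} {X : E} {s : ℝ} (h : HasLogDerivAt γ X s) (g : G) :
    HasLogDerivAt (fun t => g * γ t) X s := by
  simpa using (hasLogDerivAt_const g s).mul h

theorem HasLogDerivAt.mul_const {γ : ℝ → G} {X : E} {s : ℝ} (h : HasLogDerivAt γ X s) (g : G) :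
    HasLogDerivAt (fun t => γ t * g) (groupAd E g⁻¹ X) s := by
  simpa using h.mul (hasLogDerivAt_const g s)

theorem HasLogDerivAt.conj {γ : ℝ → G} {X : E} {s : ℝ} (h : HasLogDerivAt γ X s) (g : G) :
    HasLogDerivAt (fun t => g * γ t * g⁻¹) (groupAd E g X) s := by
  simpa using (h.const_mul g).mul_const g⁻¹

/-- `γ` is a one-parameter subgroup with velocity `X`. -/
structure IsOneParam (γ : ℝ → G) (X : E) : Prop where
  zero : γ 0 = 1
  logDeriv : ∀ s, HasLogDerivAt γ X s

namespace IsOneParam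

variable {γ : ℝ → G} {X : E}

theorem conj (h : IsOneParam γ X) (g : G) :
    IsOneParam (fun t => g * γ t * g⁻¹) (groupAd E g X) :=
  ⟨by simp [h.zero], fun s => (h.logDeriv s).conj g⟩

omit [LieGroup 𝓘(ℝ, E) ∞ G] in
theorem neg (h : IsOneParam γ X) : IsOneParam (fun t => γ (-t)) (-X) := by
  refine ⟨by simp [h.zero], ?_⟩
  have h1 := IsMIntegralCurve.comp_mul (I := 𝓘(ℝ, E))
    (v := mulInvariantVectorField (I := 𝓘(ℝ, E)) (G := G) X) h.logDeriv (-1)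
  have h2 : γ ∘ (· * (-1 : ℝ)) = fun t => γ (-t) := by ext; simp
  have h3 : (-1 : ℝ) • X = -X := by simp
  rw [h2] at h1
  intro s
  rw [← h3]
  refine (h1 s).congr_mfderiv ?_
  have h4 := congrFun (mulInvariantVectorField_smul (I := 𝓘(ℝ, E)) (G := G) (-1 : ℝ) X) (γ (-s))
  refine ContinuousLinearMap.ext_ring ?_
  have r : ∀ a b : E, b = a → ((1 : ℝ →L[ℝ] ℝ).smulRight a) 1 = ((1 : ℝ →L[ℝ] ℝ).smulRight b) 1 := by
    rintro a b rfl; rfl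
  exact r _ _ h4

variable [T2Space G]

theorem unique {γ' : ℝ → G} (h : IsOneParam γ X) (h' : IsOneParam γ' X) : γ = γ' :=
  integralCurve_unique h.logDeriv h'.logDeriv (s := 0) (by rw [h.zero, h'.zero])

theorem map_add (h : IsOneParam γ X) (s t : ℝ) : γ (s + t) = γ s * γ t := by
  have h1 : ∀ t, HasLogDerivAt (fun t => γ (t + s)) X t :=
    IsMIntegralCurve.comp_add (I := 𝓘(ℝ, E))
      (v := mulInvariantVectorField (I := 𝓘(ℝ, E)) (G := G) X) h.logDeriv s
  have h2 := integralCurve_unique h1 (fun t => (h.logDeriv t).const_mul (γ s)) (s := 0)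
    (by simp [h.zero])
  rw [add_comm]
  exact congrFun h2 t

theorem map_neg (h : IsOneParam γ X) (s : ℝ) : γ (-s) = (γ s)⁻¹ :=
  eq_inv_of_mul_eq_one_left (by rw [← h.map_add, neg_add_cancel, h.zero])

theorem map_natCast (h : IsOneParam γ X) (n : ℕ) : γ n = γ 1 ^ n := by
  induction n with
  | zero => simp [h.zero]
  | succ n ih => rw [Nat.cast_succ, h.map_add, ih, pow_succ]

/-- The curve `y(s) = Ad (γ s) Y` solves `y' = T y`, so `exp(-sT) y(s)` is constant. -/
theorem groupAd_eq_exp [CompleteSpace E] (h : IsOneParam γ X) (T : E →L[ℝ] E)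
    (hT : ∀ Y, T Y = groupBracket G X Y) (s : ℝ) :
    groupAd E (γ s) = NormedSpace.exp (s • T) := by
  ext Y
  have hy : ∀ s, HasDerivAt (fun s => groupAd E (γ s) Y) (T (groupAd E (γ s) Y)) s := by
    intro s
    have h1 := hasDerivAt_groupAd_zero h.zero (h.logDeriv 0) (groupAd E (γ s) Y)
    rw [← hT] at h1
    have h2 : (fun t => groupAd E (γ t) (groupAd E (γ s) Y)) = fun t => groupAd E (γ (t + s)) Y := by
      ext t
      rw [h.map_add, groupAd_mul]; rfl
    rw [h2] at h1
    have h3 : HasDerivAt (fun t => groupAd E (γ (t + s)) Y) (T (groupAd E (γ s) Y)) (s - s) := by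
      rwa [sub_self]
    simpa using h3.comp_sub_const s s
  have hc : ∀ s, HasDerivAt (fun s : ℝ => NormedSpace.exp (s • (-T)) (groupAd E (γ s) Y)) 0 s := by
    intro s
    have := (hasDerivAt_exp_smul_const (𝕂 := ℝ) (-T) s).clm_apply (hy s)
    convert this using 1
    simp
  have hconst := is_const_of_deriv_eq_zero (fun s => (hc s).differentiableAt)
    (fun s => (hc s).deriv) s 0
  simp only [h.zero, groupAd_one, zero_smul, NormedSpace.exp_zero] at hconst
  have h4 : NormedSpace.exp (s • T) * NormedSpace.exp (s • (-T)) = 1 := by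
    let _ : NormedAlgebra ℚ (E →L[ℝ] E) := NormedAlgebra.restrictScalars ℚ ℝ _
    rw [← NormedSpace.exp_add_of_commute]
    · simp
    · exact ((Commute.refl T).neg_right.smul_left s).smul_right s
  calc groupAd E (γ s) Y = (NormedSpace.exp (s • T) * NormedSpace.exp (s • (-T)))
        (groupAd E (γ s) Y) := by rw [h4]; rfl
    _ = NormedSpace.exp (s • T) (NormedSpace.exp (s • (-T)) (groupAd E (γ s) Y)) := rfl
    _ = _ := by rw [hconst]; rfl

end IsOneParam

theorem hasSum_exp_apply [CompleteSpace E] (T : E →L[ℝ] E) (Y : E) :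
    HasSum (fun k : ℕ => ((k.factorial : ℝ)⁻¹) • (T ^ k) Y) (NormedSpace.exp T Y) := by
  have h := NormedSpace.exp_series_hasSum_exp' (𝕂 := ℝ) T
  simpa using h.mapL (ContinuousLinearMap.apply ℝ E Y)

theorem exp_apply_congr [CompleteSpace E] {S T : E →L[ℝ] E} {Y : E}
    (h : ∀ k : ℕ, (S ^ k) Y = (T ^ k) Y) : NormedSpace.exp S Y = NormedSpace.exp T Y := by
  have h1 := hasSum_exp_apply S Y
  simp only [h] at h1
  exact h1.unique (hasSum_exp_apply T Y)

/-- The one-parameter subgroups of `X + v`, `X` and `X + w` combine to that of `X + v + w` if the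
first and the third of them act on `v` in the same way. -/
theorem IsOneParam.combine [CompleteSpace E] [T2Space G] {X v w : E} {A B C D : ℝ → G}
    (hA : IsOneParam A (X + v))
    (hB : IsOneParam B X) (hC : IsOneParam C (X + w)) (hD : IsOneParam D (X + v + w))
    (hX : ∀ s, groupAd E (B s) X = X) (hv : ∀ s, groupAd E (C s) v = groupAd E (B s) v) (s : ℝ) :
    D s = A s * (B s)⁻¹ * C s := by
  have key : IsOneParam (fun s => A s * B (-s) * C s) (X + v + w) := by
    refine ⟨by simp [hA.zero, hB.zero, hC.zero], fun s => ?_⟩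
    have h1 := ((hA.logDeriv s).mul (hB.neg.logDeriv s)).mul (hC.logDeriv s)
    have h2 : (B (-s))⁻¹ = B s := by rw [hB.map_neg, inv_inv]
    -- `Ad (B s)` fixes `X`, so the inner bracket is `Ad (B s) v = Ad (C s) v`, and `Ad (C s)⁻¹`
    -- returns `v`.
    have h3 : groupAd E (C s)⁻¹ (groupAd E (B (-s))⁻¹ (X + v) + -X) + (X + w) = X + v + w := by
      rw [h2, (groupAd E (B s)).map_add, hX, ← hv]
      simp [groupAd_inv_apply_self]
      abel
    rwa [h3] at h1
  rw [hD.unique key, ← hB.map_neg]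

end LieGroup

/-! ### Homogeneous quasimorphisms. -/

namespace IsHomogeneousQuasimorphism

variable {G : Type*} [Group G] [TopologicalSpace G] {f : G → ℝ}

theorem map_inv (hf : IsHomogeneousQuasimorphism f) (x : G) : f x⁻¹ = -f x := by
  simpa using hf.homogeneous x (-1)

theorem map_pow (hf : IsHomogeneousQuasimorphism f) (x : G) (n : ℕ) : f (x ^ n) = n * f x := by
  simpa using hf.homogeneous x n

theorem eq_zero_of_bounded {c D : ℝ} (h : ∀ n : ℕ, |n * c| ≤ D) : c = 0 := by
  by_contra hc
  obtain ⟨n, hn⟩ := exists_nat_gt (D / |c|)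
  have h1 := h n
  rw [div_lt_iff₀ (abs_pos.mpr hc)] at hn
  rw [abs_mul, Nat.abs_cast] at h1
  linarith

/-- On `g xⁿ g⁻¹` the contributions of `g` and `g⁻¹` cancel, so `n` times the difference of the two
sides stays within twice the defect. -/
theorem conj (hf : IsHomogeneousQuasimorphism f) (g x : G) : f (g * x * g⁻¹) = f x := by
  obtain ⟨D, hD⟩ := hf.bounded_defect
  refine sub_eq_zero.mp (eq_zero_of_bounded (D := D + D) fun n => ?_)
  have h1 := abs_le.mp (hD (g * x ^ n) g⁻¹)
  have h2 := abs_le.mp (hD g (x ^ n))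
  rw [← conj_pow, hf.map_pow, hf.map_inv] at h1
  rw [hf.map_pow] at h2
  rw [abs_le]
  constructor <;> nlinarith

end IsHomogeneousQuasimorphism
-- Constraints on quasi-states that come from quasimorphisms.
section

variable {E : Type*} [NormedAddCommGroup E] [NormedSpace ℝ E] [FiniteDimensional ℝ E]
  {G : Type*} [TopologicalSpace G] [T2Space G] [ChartedSpace E G] [Group G]
  [LieGroup 𝓘(ℝ, E) ∞ G]
  {g : Type*} [LieRing g] [LieAlgebra ℝ g]

omit [FiniteDimensional ℝ E] [T2Space G] in
/-- An identification of the Lie algebra of a Lie group, as a map to the model space. -/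
noncomputable def modelEquiv [CompleteSpace E] (e : g ≃ₗ⁅ℝ⁆ GroupLieAlgebra 𝓘(ℝ, E) G) : g ≃ₗ[ℝ] E :=
  e.toLinearEquiv

omit [FiniteDimensional ℝ E] [T2Space G] in
theorem groupBracket_modelEquiv [CompleteSpace E] (e : g ≃ₗ⁅ℝ⁆ GroupLieAlgebra 𝓘(ℝ, E) G)
    (X Y : g) : groupBracket G (modelEquiv e X) (modelEquiv e Y) = modelEquiv e ⁅X, Y⁆ :=
  (e.map_lie X Y).symm

/-- The adjoint action of an element of `g` on the model space of a Lie group with Lie algebra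
`g`. -/
noncomputable def modelAd (e : g ≃ₗ⁅ℝ⁆ GroupLieAlgebra 𝓘(ℝ, E) G) (X : g) : E →L[ℝ] E :=
  LinearMap.toContinuousLinearMap
    ((modelEquiv e).toLinearMap ∘ₗ (LieAlgebra.ad ℝ g X : g →ₗ[ℝ] g) ∘ₗ
      (modelEquiv e).symm.toLinearMap)

omit [T2Space G] in
theorem modelAd_modelEquiv (e : g ≃ₗ⁅ℝ⁆ GroupLieAlgebra 𝓘(ℝ, E) G) (X Y : g) :
    modelAd e X (modelEquiv e Y) = modelEquiv e ⁅X, Y⁆ := by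
  simp [modelAd]

omit [T2Space G] in
theorem modelAd_apply (e : g ≃ₗ⁅ℝ⁆ GroupLieAlgebra 𝓘(ℝ, E) G) (X : g) (Y : E) :
    modelAd e X Y = groupBracket G (modelEquiv e X) Y := by
  obtain ⟨Z, rfl⟩ := (modelEquiv e).surjective Y
  rw [modelAd_modelEquiv, groupBracket_modelEquiv]

omit [T2Space G] in
theorem modelAd_pow_modelEquiv (e : g ≃ₗ⁅ℝ⁆ GroupLieAlgebra 𝓘(ℝ, E) G) (X Y : g) (k : ℕ) :
    (modelAd e X ^ k) (modelEquiv e Y) = modelEquiv e ((LieAlgebra.ad ℝ g X ^ k) Y) := by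
  induction k with
  | zero => rfl
  | succ k ih =>
    rw [pow_succ', pow_succ', Module.End.mul_apply, mul_apply_eq_comp, ih,
      modelAd_modelEquiv, LieAlgebra.ad_apply]

variable [FiniteDimensional ℝ g] [TopologicalSpace g] [IsTopologicalAddGroup g]
  [ContinuousSMul ℝ g] [T2Space g]

omit [FiniteDimensional ℝ g] [T2Space G] in
theorem modelEquiv_expAd (e : g ≃ₗ⁅ℝ⁆ GroupLieAlgebra 𝓘(ℝ, E) G) (X Y : g) :
    modelEquiv e (expAd X Y) = NormedSpace.exp (modelAd e X) (modelEquiv e Y) := by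
  have h := (hasSum_exp_apply (modelAd e X) (modelEquiv e Y)).mapL
    (LinearMap.toContinuousLinearMap (modelEquiv e).symm.toLinearMap)
  have h1 : HasSum (fun k : ℕ => ((k.factorial : ℝ)⁻¹) • ((LieAlgebra.ad ℝ g X) ^ k) Y)
      ((modelEquiv e).symm (NormedSpace.exp (modelAd e X) (modelEquiv e Y))) := by
    simpa only [modelAd_pow_modelEquiv, map_smul, LinearMap.coe_toContinuousLinearMap',
      LinearEquiv.coe_coe, LinearEquiv.symm_apply_apply] using h
  have h2 : expAd X Y = _ := h1.tsum_eq
  rw [h2, LinearEquiv.apply_symm_apply]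

omit [FiniteDimensional ℝ g] [IsTopologicalAddGroup g] [ContinuousSMul ℝ g] [T2Space g] in
theorem qm_data {ζ : g → ℝ} (hζ : ζ ∈ qmQuasiStates g) :
    ∃ (E : Type) (_ : NormedAddCommGroup E) (_ : NormedSpace ℝ E) (_ : FiniteDimensional ℝ E)
      (G : Type) (_ : TopologicalSpace G) (_ : T2Space G)
      (_ : ChartedSpace E G) (_ : Group G) (_ : LieGroup 𝓘(ℝ, E) ∞ G)
      (e : g ≃ₗ⁅ℝ⁆ GroupLieAlgebra 𝓘(ℝ, E) G) (f : G → ℝ) (γ : g → ℝ → G),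
      IsHomogeneousQuasimorphism f ∧ (∀ X, IsOneParam (γ X) (modelEquiv e X)) ∧
      ∀ X, ζ X = f (γ X 1) := by
  obtain ⟨-, -, E, i1, i2, i3, G, i4, i5, -, i6, i7, i8, e, f, hf, h⟩ := hζ
  choose x hx hζx using h
  choose γ h0 hγ h1 using hx
  refine ⟨E, i1, i2, i3, G, i4, i5, i6, i7, i8, e, f, γ, hf, fun X => ⟨h0 X, hγ X⟩, fun X => ?_⟩
  rw [hζx, h1]

omit [FiniteDimensional ℝ g] in
-- Conjugating the one-parameter group of `Y` by `exp X` gives that of `exp (ad X) Y`, and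
-- homogeneous quasimorphisms are conjugation invariant.
theorem isAdInvariant_of_mem_qm {ζ : g → ℝ} (hζ : ζ ∈ qmQuasiStates g) : IsAdInvariant ζ := by
  obtain ⟨E, _, _, _, G, _, _, _, _, _, e, f, γ, hf, hγ, hζ⟩ := qm_data hζ
  intro X Y
  have h1 := (hγ Y).conj (γ X 1)
  rw [(hγ X).groupAd_eq_exp (modelAd e X) (modelAd_apply e X), one_smul, ← modelEquiv_expAd] at h1
  rw [hζ, hζ, (hγ (expAd X Y)).unique h1, hf.conj]

omit [FiniteDimensional ℝ g] [IsTopologicalAddGroup g] [ContinuousSMul ℝ g] [T2Space g] in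
-- The obstruction to rigidity. Evaluating `f` on the factorisation `IsOneParam.combine` at time `n`
-- costs at most two defects, while all terms are linear in `n`.
theorem affine_of_mem_qm {ζ : g → ℝ} (hζ : ζ ∈ qmQuasiStates g) {X v w : g}
    (h : ∀ k : ℕ, (LieAlgebra.ad ℝ g (X + w) ^ k) v = (LieAlgebra.ad ℝ g X ^ k) v) :
    ζ (X + v + w) + ζ X = ζ (X + v) + ζ (X + w) := by
  obtain ⟨E, _, _, _, G, _, _, _, _, _, e, f, γ, hf, hγ, hζ⟩ := qm_data hζ
  have hX : ∀ s, groupAd E (γ X s) (modelEquiv e X) = (modelEquiv e X) := by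
    intro s
    rw [(hγ X).groupAd_eq_exp (modelAd e X) (modelAd_apply e X)]
    -- Positive powers of `ad X` kill `X`, so on `X` the exponential agrees with `exp 0`.
    have : NormedSpace.exp (0 : E →L[ℝ] E) (modelEquiv e X) = (modelEquiv e X) := by
      rw [NormedSpace.exp_zero]; rfl
    rw [← this]
    conv_lhs => rw [this]
    refine exp_apply_congr fun k => ?_
    rw [smul_pow]
    have h1 := modelAd_pow_modelEquiv e X X k
    cases k with
    | zero => simp
    | succ k =>
      have h2 : (LieAlgebra.ad ℝ g X ^ (k + 1)) X = 0 := by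
        rw [pow_succ, Module.End.mul_apply]; simp
      rw [h2] at h1
      rw [smul_apply, h1, map_zero]
      simp
  have hv : ∀ s, groupAd E (γ (X + w) s) (modelEquiv e v) = groupAd E (γ X s) (modelEquiv e v) := by
    intro s
    rw [(hγ X).groupAd_eq_exp (modelAd e X) (modelAd_apply e X),
      (hγ (X + w)).groupAd_eq_exp (modelAd e (X + w)) (modelAd_apply e (X + w))]
    refine exp_apply_congr fun k => ?_
    rw [smul_pow, smul_pow, smul_apply, smul_apply,
      modelAd_pow_modelEquiv, modelAd_pow_modelEquiv, h]
  have key : ∀ n : ℕ, γ (X + v + w) n = γ (X + v) n * (γ X n)⁻¹ * γ (X + w) n := fun n =>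
    IsOneParam.combine (X := (modelEquiv e X)) (v := (modelEquiv e v)) (w := (modelEquiv e w))
      (by simpa using hγ (X + v)) (hγ X) (by simpa using hγ (X + w))
      (by simpa using hγ (X + v + w)) hX hv n
  obtain ⟨D, hD⟩ := hf.bounded_defect
  have hn : ∀ (Y : g) (n : ℕ), f (γ Y n) = n * ζ Y := fun Y n => by
    rw [(hγ Y).map_natCast, hf.map_pow, hζ]
  rw [← sub_eq_zero]
  refine IsHomogeneousQuasimorphism.eq_zero_of_bounded (D := D + D) fun n => ?_
  have h1 := abs_le.mp (hD (γ (X + v) n * (γ X n)⁻¹) (γ (X + w) n))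
  have h2 := abs_le.mp (hD (γ (X + v) n) (γ X n)⁻¹)
  rw [← key, hn, hn] at h1
  rw [hf.map_inv, hn, hn] at h2
  rw [abs_le]
  constructor <;> nlinarith

end
-- The Lie group `W ⋊ ℝ` and its homomorphisms to `ℝ`.
section FlowGroup

open VectorField Set Filter
open scoped Topology

/-- The semidirect product of a vector space and the real line acting by `t ↦ exp (t T)`. -/
def FlowGroup {W : Type} [NormedAddCommGroup W] [NormedSpace ℝ W] (_ : W →L[ℝ] W) : Type := W × ℝ

variable {W : Type} [NormedAddCommGroup W] [NormedSpace ℝ W] (T : W →L[ℝ] W)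

/-- The flow `exp (t T)`. -/
noncomputable def flow (t : ℝ) : W →L[ℝ] W := NormedSpace.exp (t • T)

namespace FlowGroup

instance : TopologicalSpace (FlowGroup T) := inferInstanceAs (TopologicalSpace (W × ℝ))

instance : T2Space (FlowGroup T) := inferInstanceAs (T2Space (W × ℝ))

instance [SecondCountableTopology W] : SecondCountableTopology (FlowGroup T) :=
  inferInstanceAs (SecondCountableTopology (W × ℝ))

instance : ChartedSpace (W × ℝ) (FlowGroup T) := inferInstanceAs (ChartedSpace (W × ℝ) (W × ℝ))

end FlowGroup

variable [CompleteSpace W]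

omit [CompleteSpace W] in
theorem flow_zero : flow T 0 = 1 := by simp [flow]

theorem flow_add (s t : ℝ) : flow T (s + t) = flow T s * flow T t := by
  let _ : NormedAlgebra ℚ (W →L[ℝ] W) := NormedAlgebra.restrictScalars ℚ ℝ _
  rw [flow, add_smul, NormedSpace.exp_add_of_commute]
  · rfl
  · exact ((Commute.refl T).smul_left s).smul_right t

theorem contDiff_flow : ContDiff ℝ ∞ (flow T) := by
  have h : AnalyticOnNhd ℝ (NormedSpace.exp : (W →L[ℝ] W) → (W →L[ℝ] W)) univ :=
    fun x _ => NormedSpace.exp_analytic x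
  exact h.contDiff.comp (contDiff_id.smul contDiff_const)

theorem hasDerivAt_flow (t : ℝ) : HasDerivAt (flow T) (T * flow T t) t :=
  hasDerivAt_exp_smul_const' (𝕂 := ℝ) T t

namespace FlowGroup

noncomputable instance : Group (FlowGroup T) where
  mul p q := (p.1 + flow T p.2 q.1, p.2 + q.2)
  one := (0, 0)
  inv p := (-flow T (-p.2) p.1, -p.2)
  mul_assoc p q r := by
    refine Prod.ext ?_ (add_assoc _ _ _)
    change p.1 + flow T p.2 q.1 + flow T (p.2 + q.2) r.1 =
      p.1 + flow T p.2 (q.1 + flow T q.2 r.1)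
    rw [flow_add, mul_apply_eq_comp, map_add, add_assoc]
  one_mul p := by
    refine Prod.ext ?_ (zero_add _)
    change 0 + flow T 0 p.1 = p.1
    rw [flow_zero, zero_add]; rfl
  mul_one p := by
    refine Prod.ext ?_ (add_zero _)
    change p.1 + flow T p.2 0 = p.1
    rw [map_zero, add_zero]
  inv_mul_cancel p := by
    refine Prod.ext ?_ (neg_add_cancel _)
    change -flow T (-p.2) p.1 + flow T (-p.2) p.1 = 0
    rw [neg_add_cancel]

instance : LieGroup 𝓘(ℝ, W × ℝ) ∞ (FlowGroup T) where
  __ := (inferInstanceAs (IsManifold 𝓘(ℝ, W × ℝ) ∞ (W × ℝ)) : IsManifold 𝓘(ℝ, W × ℝ) ∞ (FlowGroup T))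
  contMDiff_mul := by
    have hF : ContDiff ℝ ∞ (fun p : (W × ℝ) × (W × ℝ) =>
        (p.1.1 + flow T p.1.2 p.2.1, p.1.2 + p.2.2)) := by
      refine ContDiff.prodMk (contDiff_fst.fst.add ?_) (contDiff_fst.snd.add contDiff_snd.snd)
      exact ((contDiff_flow T).comp contDiff_fst.snd).clm_apply contDiff_snd.fst
    -- The identity mediates between the product of the two models and the model on the product
    -- space, where smoothness is plain `ContDiff`.
    have h1 : ContMDiff (𝓘(ℝ, W × ℝ).prod 𝓘(ℝ, W × ℝ)) 𝓘(ℝ, (W × ℝ) × (W × ℝ)) ∞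
        (fun p : (W × ℝ) × (W × ℝ) => p) :=
      contMDiff_fst.prodMk_space contMDiff_snd
    exact hF.comp_contMDiff h1
  contMDiff_inv := by
    have hF : ContDiff ℝ ∞ (fun p : W × ℝ => (-flow T (-p.2) p.1, -p.2)) := by
      refine ContDiff.prodMk (ContDiff.neg ?_) contDiff_snd.neg
      exact ((contDiff_flow T).comp contDiff_snd.neg).clm_apply contDiff_fst
    exact hF.contMDiff

theorem mulInvariantVectorField_apply (X : W × ℝ) (p : FlowGroup T) :
    (mulInvariantVectorField (I := 𝓘(ℝ, W × ℝ)) (G := FlowGroup T) X p : W × ℝ) =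
      (flow T p.2 X.1, X.2) := by
  have h : HasFDerivAt (fun q : W × ℝ => ((p.1 + flow T p.2 q.1, p.2 + q.2) : W × ℝ))
      (((flow T p.2).comp (ContinuousLinearMap.fst ℝ W ℝ)).prod (ContinuousLinearMap.snd ℝ W ℝ))
      (0, 0) := by
    refine HasFDerivAt.prodMk (HasFDerivAt.const_add _ ?_) (HasFDerivAt.const_add _ hasFDerivAt_snd)
    exact (flow T p.2).hasFDerivAt.comp _ hasFDerivAt_fst
  have h1 : (mfderiv 𝓘(ℝ, W × ℝ) 𝓘(ℝ, W × ℝ) (fun q : FlowGroup T => p * q) 1 :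
      W × ℝ →L[ℝ] W × ℝ) = ((flow T p.2).comp (ContinuousLinearMap.fst ℝ W ℝ)).prod
        (ContinuousLinearMap.snd ℝ W ℝ) :=
    h.hasMFDerivAt.mfderiv
  exact DFunLike.congr_fun h1 X

/-- The global chart reduces this to the bracket of the fields `p ↦ (exp(p.2 T) X.1, X.2)`, whose
derivative at the origin is `p ↦ (p.2 • T X.1, 0)`. -/
theorem groupBracket_eq (X Y : W × ℝ) :
    groupBracket (FlowGroup T) X Y = (X.2 • T Y.1 - Y.2 • T X.1, 0) := by
  have h : ∀ Y : W × ℝ, HasFDerivAt (fun p : W × ℝ => ((flow T p.2 Y.1, Y.2) : W × ℝ))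
      (((ContinuousLinearMap.snd ℝ W ℝ).smulRight (T Y.1)).prod 0) (0, 0) := by
    intro Y
    refine HasFDerivAt.prodMk ?_ (hasFDerivAt_const _ _)
    have h1 := ((hasDerivAt_flow T 0).clm_apply (hasDerivAt_const 0 Y.1))
    have h2 := HasFDerivAt.comp (g := fun t => flow T t Y.1) ((0 : W), (0 : ℝ)) h1.hasFDerivAt
      (hasFDerivAt_snd (𝕜 := ℝ) (E := W) (F := ℝ) (p := (0, 0)))
    refine h2.congr_fderiv (ContinuousLinearMap.ext fun p => ?_)
    simp [flow_zero]
  have e : ∀ Y : W × ℝ, (fun p => (mulInvariantVectorField (I := 𝓘(ℝ, W × ℝ)) (G := FlowGroup T) Y p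
      : W × ℝ)) = fun p : W × ℝ => ((flow T p.2 Y.1, Y.2) : W × ℝ) :=
    fun Y => funext fun p => mulInvariantVectorField_apply T Y p
  have h2 : groupBracket (FlowGroup T) X Y = mlieBracketWithin 𝓘(ℝ, W × ℝ)
      (fun p : W × ℝ => ((flow T p.2 X.1, X.2) : W × ℝ))
      (fun p : W × ℝ => ((flow T p.2 Y.1, Y.2) : W × ℝ)) univ ((0, 0) : W × ℝ) := by
    rw [← e, ← e]; rfl
  have h3 := congrFun (mlieBracketWithin_eq_lieBracketWithin (𝕜 := ℝ)
      (V := fun p : W × ℝ => ((flow T p.2 X.1, X.2) : W × ℝ))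
      (W := fun p : W × ℝ => ((flow T p.2 Y.1, Y.2) : W × ℝ)) (s := univ)) ((0, 0) : W × ℝ)
  refine h2.trans (h3.trans ?_)
  rw [lieBracketWithin_univ, lieBracket, (h X).fderiv, (h Y).fderiv]
  simp
  rfl

/-- The one-parameter subgroups of the semidirect product. -/
noncomputable def oneParam (X : W × ℝ) (s : ℝ) : FlowGroup T :=
  ((∫ u in (0 : ℝ)..s, flow T (u * X.2) X.1, s * X.2) : W × ℝ)

theorem continuous_flow_apply (X : W × ℝ) : Continuous fun u : ℝ => flow T (u * X.2) X.1 :=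
  ((contDiff_flow T).continuous.comp (continuous_id.mul continuous_const)).clm_apply
    continuous_const

theorem isOneParam_oneParam (X : W × ℝ) : IsOneParam (oneParam T X) X := by
  constructor
  · change ((∫ u in (0 : ℝ)..0, flow T (u * X.2) X.1, 0 * X.2) : W × ℝ) = (0, 0)
    simp
  · intro s
    have h1 : HasDerivAt (fun s => ((∫ u in (0 : ℝ)..s, flow T (u * X.2) X.1, s * X.2) : W × ℝ))
        (flow T (s * X.2) X.1, X.2) s := by
      refine HasDerivAt.prodMk ?_ (by simpa using (hasDerivAt_id s).mul_const X.2)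
      exact ((continuous_flow_apply T X).integral_hasStrictDerivAt 0 s).hasDerivAt
    refine h1.hasFDerivAt.hasMFDerivAt.congr_mfderiv ?_
    refine ContinuousLinearMap.ext_ring ?_
    have h2 := mulInvariantVectorField_apply T X (oneParam T X s)
    have r : ∀ a b : W × ℝ, b = a →
        (ContinuousLinearMap.toSpanSingleton ℝ a) 1 = ((1 : ℝ →L[ℝ] ℝ).smulRight b) 1 := by
      rintro a b rfl; simp
    exact r _ _ h2

end FlowGroup

/-- Only the constant term of the exponential series survives `ℓ`. -/
theorem apply_flow {ℓ : W →L[ℝ] ℝ} (h : ∀ w, ℓ (T w) = 0) (t : ℝ) (w : W) :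
    ℓ (flow T t w) = ℓ w := by
  have h1 := (hasSum_exp_apply (t • T) w).mapL ℓ
  have h2 := hasSum_single (f := fun k : ℕ => ℓ (((k.factorial : ℝ)⁻¹) • ((t • T) ^ k) w)) 0 (by
    intro k hk
    obtain ⟨k, rfl⟩ := Nat.exists_eq_succ_of_ne_zero hk
    rw [map_smul, pow_succ', mul_apply_eq_comp, smul_apply, map_smul, h, smul_zero, smul_zero])
  simpa [flow] using h1.unique h2

/-- Flow invariance of `ℓ` makes this a homomorphism, so the defect is zero. -/
theorem isHomogeneousQuasimorphism_flowGroup {ℓ : W →L[ℝ] ℝ} (h : ∀ w, ℓ (T w) = 0) (c : ℝ) :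
    IsHomogeneousQuasimorphism (fun p : FlowGroup T => ℓ p.1 + c * p.2) := by
  let F : FlowGroup T →* Multiplicative ℝ :=
    { toFun := fun p => Multiplicative.ofAdd (ℓ p.1 + c * p.2)
      map_one' := by
        change Multiplicative.ofAdd (ℓ (0 : W) + c * (0 : ℝ)) = 1
        simp
      map_mul' := fun p q => by
        change Multiplicative.ofAdd (ℓ (p.1 + flow T p.2 q.1) + c * (p.2 + q.2)) =
          Multiplicative.ofAdd ((ℓ p.1 + c * p.2) + (ℓ q.1 + c * q.2))
        refine congrArg Multiplicative.ofAdd ?_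
        rw [ℓ.map_add, apply_flow T h]
        ring }
  have hF : ∀ p, ℓ p.1 + c * p.2 = (F p).toAdd := fun _ => rfl
  refine ⟨?_, ⟨0, fun x y => ?_⟩, fun x n => ?_⟩
  · have : Continuous (fun p : W × ℝ => ℓ p.1 + c * p.2) := by fun_prop
    exact this
  · simp only [hF, map_mul, toAdd_mul]
    simp
  · simp only [hF, map_zpow, toAdd_zpow]
    simp

theorem apply_oneParam {ℓ : W →L[ℝ] ℝ} (h : ∀ w, ℓ (T w) = 0) (X : W × ℝ) :
    ℓ (FlowGroup.oneParam T X 1).1 = ℓ X.1 := by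
  have h1 : ℓ (∫ u in (0 : ℝ)..1, flow T (u * X.2) X.1) =
      ∫ u in (0 : ℝ)..1, ℓ (flow T (u * X.2) X.1) :=
    (ℓ.intervalIntegral_comp_comm
      ((FlowGroup.continuous_flow_apply T X).intervalIntegrable 0 1)).symm
  refine h1.trans ?_
  simp [apply_flow T h]

end FlowGroup
-- Splitting off a nilpotent Jordan block.
section JordanBlock

variable {V : Type*} [AddCommGroup V] [Module ℝ V]

/-- Let `N` be the least exponent at which the images of the powers of `φ` stabilise. The hypothesis
excludes `N = 0` and `N = 1`, so `N = n + 2`; the vector generates a block of size `N` and `α`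
detects its end. -/
theorem exists_cyclic_vector [FiniteDimensional ℝ V] (φ : Module.End ℝ V)
    (h : LinearMap.range (φ ^ 2) < LinearMap.range φ) :
    ∃ (n : ℕ) (v : V) (α : V →ₗ[ℝ] ℝ), (φ ^ (n + 2)) v = 0 ∧ (∀ x, α ((φ ^ (n + 2)) x) = 0) ∧
      α ((φ ^ (n + 1)) v) = 1 := by
  classical
  have hle : ∀ m k, LinearMap.range (φ ^ (m + k)) ≤ LinearMap.range (φ ^ m) := by
    rintro m k _ ⟨x, rfl⟩
    exact ⟨(φ ^ k) x, by rw [pow_add]; rfl⟩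
  have hex : ∃ n, LinearMap.range (φ ^ n) = LinearMap.range (φ ^ (n + 1)) := by
    obtain ⟨k, -, hk⟩ := Module.End.exists_ker_pow_eq_ker_pow_succ φ
    refine ⟨k, (Submodule.eq_of_le_of_finrank_eq (hle k 1) ?_).symm⟩
    have h1 := LinearMap.finrank_range_add_finrank_ker (φ ^ k)
    have h2 := LinearMap.finrank_range_add_finrank_ker (φ ^ (k + 1))
    rw [Nat.succ_eq_add_one] at hk
    rw [← hk] at h2
    omega
  have hmin : ∀ m < Nat.find hex, LinearMap.range (φ ^ m) ≠ LinearMap.range (φ ^ (m + 1)) :=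
    fun m hm => Nat.find_min hex hm
  have hspec := Nat.find_spec hex
  set N := Nat.find hex
  have hstable : ∀ k, LinearMap.range (φ ^ (N + k)) = LinearMap.range (φ ^ N) := by
    intro k
    induction k with
    | zero => rfl
    | succ k ih =>
      refine le_antisymm (hle _ _) ?_
      rw [hspec]
      rintro _ ⟨x, rfl⟩
      have : (φ ^ N) x ∈ LinearMap.range (φ ^ (N + k)) := by rw [ih]; exact ⟨x, rfl⟩
      obtain ⟨y, hy⟩ := this
      refine ⟨y, ?_⟩
      rw [← add_assoc, pow_succ', pow_succ', Module.End.mul_apply, Module.End.mul_apply, hy]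
  have h0 : N ≠ 0 := by
    intro h0
    rw [h0, pow_zero, zero_add, pow_one] at hspec
    refine h.ne (le_antisymm h.le ?_)
    rintro _ ⟨x, rfl⟩
    have : x ∈ LinearMap.range φ := by rw [← hspec]; exact ⟨x, rfl⟩
    obtain ⟨y, rfl⟩ := this
    exact ⟨y, by rw [pow_two]; rfl⟩
  have h1 : N ≠ 1 := by
    intro h1
    rw [h1, pow_one] at hspec
    exact h.ne hspec.symm
  obtain ⟨n, hn⟩ : ∃ n, N = n + 2 := ⟨N - 2, by omega⟩
  rw [hn] at hspec hmin hstable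
  obtain ⟨_, ⟨x, rfl⟩, hx⟩ := SetLike.exists_of_lt
    (lt_of_le_of_ne (hle (n + 1) 1) (hmin (n + 1) (by omega)).symm)
  -- With `φ^N x = φ^(2N) y`, the vector `x - φ^N y` is killed by `φ^N`. The correction leaves
  -- `φ^(N-1) x` unchanged modulo `im φ^N`.
  have hxs : (φ ^ (n + 2)) x ∈ LinearMap.range (φ ^ (n + 2 + (n + 2))) := by
    rw [hstable]; exact ⟨x, rfl⟩
  obtain ⟨y, hy⟩ := hxs
  have hv : (φ ^ (n + 1)) (x - (φ ^ (n + 2)) y) ∉ LinearMap.range (φ ^ (n + 2)) := by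
    intro hmem
    refine hx ?_
    have h2 : (φ ^ (n + 1)) ((φ ^ (n + 2)) y) ∈ LinearMap.range (φ ^ (n + 2)) :=
      ⟨(φ ^ (n + 1)) y, by
        rw [← Module.End.mul_apply, ← Module.End.mul_apply, ← pow_add, ← pow_add, add_comm]⟩
    have := add_mem hmem h2
    rwa [← map_add, sub_add_cancel] at this
  obtain ⟨α, hα, hα1⟩ := LinearMap.exists_extend_of_notMem
    (0 : LinearMap.range (φ ^ (n + 2)) →ₗ[ℝ] ℝ) hv 1
  refine ⟨n, x - (φ ^ (n + 2)) y, α, ?_, fun z => ?_, hα1⟩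
  · rw [map_sub, ← Module.End.mul_apply, ← pow_add, hy, sub_self]
  · exact DFunLike.congr_fun hα ⟨_, z, rfl⟩

/-- `V₀` is spanned by `v, φ v, …, φ^(n-1) v` and `V₁` is the common kernel of the `α ∘ φ^i`, `i <
n`. The pairing matrix of these vectors and functionals is unitriangular, which makes the two
complementary; `α ∘ φ^n = 0` makes `V₁` invariant. -/
theorem hasNilpotentJordanBlock_of_cyclic_vector (φ : Module.End ℝ V) {n : ℕ} (hn2 : 2 ≤ n) {v : V}
    {α : V →ₗ[ℝ] ℝ} (hv : (φ ^ n) v = 0) (hα : ∀ x, α ((φ ^ n) x) = 0)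
    (h1 : α ((φ ^ (n - 1)) v) = 1) : HasNilpotentJordanBlock φ := by
  have hvk : ∀ k, n ≤ k → (φ ^ k) v = 0 := by
    intro k hk
    obtain ⟨j, rfl⟩ := Nat.exists_eq_add_of_le' hk
    rw [pow_add, Module.End.mul_apply, hv, map_zero]
  -- The chain is listed backwards so that `φ` lowers the index, which puts the ones on the
  -- superdiagonal.
  set S : (Fin n → ℝ) →ₗ[ℝ] V :=
    Fintype.linearCombination ℝ (fun j : Fin n => (φ ^ (n - 1 - j)) v) with hS
  set T : V →ₗ[ℝ] (Fin n → ℝ) := LinearMap.pi fun i : Fin n => α ∘ₗ (φ ^ (i : ℕ)) with hT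
  have hSe : ∀ j : Fin n, S (Pi.single j 1) = (φ ^ (n - 1 - j)) v := by
    intro j; simp [hS]
  set M : Matrix (Fin n) (Fin n) ℝ := LinearMap.toMatrix' (T ∘ₗ S) with hM
  have hMa : ∀ i j : Fin n, M i j = α ((φ ^ ((i : ℕ) + (n - 1 - j))) v) := by
    intro i j
    rw [hM, LinearMap.toMatrix'_apply, LinearMap.comp_apply, hSe, pow_add]
    rfl
  have hdet : M.det = 1 := by
    rw [Matrix.det_of_isUpperTriangular]
    · refine Finset.prod_eq_one fun i _ => ?_
      rw [hMa, show (i : ℕ) + (n - 1 - i) = n - 1 by omega, h1]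
    · intro i j hij
      have : (j : ℕ) < i := hij
      rw [hMa, hvk _ (by omega), map_zero]
  have hTS : Function.Injective (T ∘ₗ S) := by
    have h2 : Function.Injective M.mulVec := by
      rw [Matrix.mulVec_injective_iff_isUnit, Matrix.isUnit_iff_isUnit_det, hdet]
      exact isUnit_one
    have h3 : T ∘ₗ S = M.toLin' := (Matrix.toLin'_toMatrix' _).symm
    rw [h3]
    exact h2
  have hTS' : Function.Surjective (T ∘ₗ S) := LinearMap.injective_iff_surjective.mp hTS
  have hSi : Function.Injective S := Function.Injective.of_comp (f := T) hTS
  have hφS : ∀ j : Fin n, φ (S (Pi.single j 1)) =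
      if h : (j : ℕ) = 0 then 0 else S (Pi.single ⟨j - 1, by omega⟩ 1) := by
    intro j
    split_ifs with h
    · rw [hSe, ← Module.End.mul_apply, ← pow_succ', hvk _ (by omega)]
    · rw [hSe, hSe, ← Module.End.mul_apply, ← pow_succ']
      congr 2
      simp only
      omega
  have hV0 : ∀ w ∈ LinearMap.range S, φ w ∈ LinearMap.range S := by
    rintro _ ⟨c, rfl⟩
    rw [← LinearMap.comp_apply, pi_eq_sum_univ' c, map_sum]
    refine Submodule.sum_mem _ fun j _ => ?_
    rw [map_smul, LinearMap.comp_apply]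
    refine Submodule.smul_mem _ _ ?_
    rw [hφS]
    split_ifs
    · exact zero_mem _
    · exact ⟨_, rfl⟩
  refine ⟨LinearMap.range S, LinearMap.ker T, hV0, ?_, ?_, n, hn2,
    (Pi.basisFun ℝ (Fin n)).map (LinearEquiv.ofInjective S hSi), ?_⟩
  · intro w hw
    have hw' : ∀ i : Fin n, α ((φ ^ (i : ℕ)) w) = 0 := fun i => congrFun (LinearMap.mem_ker.mp hw) i
    rw [LinearMap.mem_ker]
    ext i
    change α ((φ ^ (i : ℕ)) (φ w)) = 0
    rw [← Module.End.mul_apply, ← pow_succ]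
    by_cases hi : (i : ℕ) + 1 = n
    · rw [hi, hα]
    · exact hw' ⟨i + 1, by omega⟩
  · constructor
    · rw [Submodule.disjoint_def]
      rintro _ ⟨c, rfl⟩ hc
      have : (T ∘ₗ S) c = (T ∘ₗ S) 0 := by rw [map_zero]; exact hc
      rw [hTS this, map_zero]
    · rw [codisjoint_iff, Submodule.eq_top_iff']
      intro x
      obtain ⟨c, hc⟩ := hTS' (T x)
      refine Submodule.mem_sup.mpr ⟨S c, ⟨c, rfl⟩, x - S c, ?_, add_sub_cancel _ _⟩
      rw [LinearMap.mem_ker, map_sub, ← hc]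
      exact sub_self _
  · ext i j
    set b := (Pi.basisFun ℝ (Fin n)).map (LinearEquiv.ofInjective S hSi) with hb
    have hbj : ∀ j, ((b j : LinearMap.range S) : V) = S (Pi.single j 1) := by
      intro j; simp [hb]
    rw [LinearMap.toMatrix_apply, Matrix.of_apply]
    by_cases hj : (j : ℕ) = 0
    · have h3 : φ.restrict hV0 (b j) = 0 := by
        ext
        rw [LinearMap.coe_restrict_apply, hbj, hφS, dif_pos hj]; rfl
      rw [h3, map_zero, if_neg (by omega)]
      rfl
    · have h3 : φ.restrict hV0 (b j) = b ⟨j - 1, by omega⟩ := by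
        ext
        rw [LinearMap.coe_restrict_apply, hbj, hφS, dif_neg hj, hbj]
      rw [h3, Module.Basis.repr_self, Finsupp.single_apply]
      congr 1
      rw [Fin.ext_iff]
      simp only [eq_iff_iff]
      omega

/-- On the block `(φ x)ᵢ = xᵢ₊₁`: take `β` the last and `γ` the last but one coordinate of the
projection to `V₀`, which commutes with `φ`. -/
theorem exists_functionals_of_hasNilpotentJordanBlock {φ : Module.End ℝ V}
    (h : HasNilpotentJordanBlock φ) :
    ∃ β γ : V →ₗ[ℝ] ℝ, β ≠ 0 ∧ (∀ x, β (φ x) = 0) ∧ ∀ x, γ (φ x) = β x := by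
  obtain ⟨V₀, V₁, h₀, h₁, hc, n, hn, b, hb⟩ := h
  set P : V →ₗ[ℝ] V₀ := LinearMap.fst ℝ V₀ V₁ ∘ₗ (V₀.prodEquivOfIsCompl V₁ hc).symm.toLinearMap
    with hP
  have hP0 : ∀ x : V₀, P x = x := by intro x; simp [hP]
  have hP1 : ∀ x ∈ V₁, P x = 0 := by
    intro x hx
    simp [hP, hx]
  have hPφ : ∀ x, P (φ x) = φ.restrict h₀ (P x) := by
    intro x
    obtain ⟨⟨y, z⟩, rfl⟩ := (V₀.prodEquivOfIsCompl V₁ hc).surjective x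
    rw [Submodule.coe_prodEquivOfIsCompl', map_add, map_add, map_add, hP0,
      hP1 _ (h₁ _ z.2), hP1 _ z.2, add_zero, add_zero]
    exact hP0 ⟨φ y, h₀ _ y.2⟩
  have hco : ∀ (i : Fin n) (x : V), b.repr (P (φ x)) i =
      ∑ j : Fin n, (if (i : ℕ) + 1 = (j : ℕ) then (1 : ℝ) else 0) * b.repr (P x) j := by
    intro i x
    rw [hPφ, ← LinearMap.toMatrix_mulVec_repr b b, hb]
    rfl
  refine ⟨b.coord ⟨n - 1, by omega⟩ ∘ₗ P, b.coord ⟨n - 2, by omega⟩ ∘ₗ P, ?_, ?_, ?_⟩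
  · intro h
    have := DFunLike.congr_fun h (b ⟨n - 1, by omega⟩ : V)
    simp [hP0] at this
  · intro x
    change b.repr (P (φ x)) _ = 0
    rw [hco]
    refine Finset.sum_eq_zero fun j _ => ?_
    rw [if_neg (by simp only; omega), zero_mul]
  · intro x
    change b.repr (P (φ x)) _ = b.repr (P x) _
    rw [hco, Finset.sum_eq_single ⟨n - 1, by omega⟩]
    · rw [if_pos (by simp only; omega), one_mul]
    · intro j _ hj
      rw [if_neg, zero_mul]
      intro h
      exact hj (Fin.ext (by simp only at h ⊢; omega))
    · simp

end JordanBlock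
/-- The linear isomorphism `D` exhibits the Lie algebra `g` as the semidirect product of the vector
space `V` with the real line acting by `φ`. -/
def IsSplit {V g : Type*} [AddCommGroup V] [Module ℝ V] [LieRing g] [LieAlgebra ℝ g]
    (φ : Module.End ℝ V) (D : (V × ℝ) ≃ₗ[ℝ] g) : Prop :=
  ∀ (v w : V) (t s : ℝ), ⁅D (v, t), D (w, s)⁆ = D (t • φ w - s • φ v, 0)

/-! ### Heisenberg quotients. -/

section Heisenberg

attribute [local instance] LieRing.ofAssociativeRing

/-- The strictly upper triangular matrix with the given entries. -/
def heisenbergMk : (ℝ × ℝ × ℝ) →ₗ[ℝ] heisenberg where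
  toFun x := ⟨!![0, x.1, x.2.2; 0, 0, x.2.1; 0, 0, 0], by
    intro i j h
    fin_cases i <;> fin_cases j <;> first | rfl | exact absurd h (by decide)⟩
  map_add' x y := by
    ext i j
    fin_cases i <;> fin_cases j <;> simp
  map_smul' r x := by
    ext i j
    fin_cases i <;> fin_cases j <;> simp

theorem heisenbergMk_surjective : Function.Surjective heisenbergMk := by
  rintro ⟨A, hA⟩
  refine ⟨(A 0 1, A 1 2, A 0 2), Subtype.ext ?_⟩
  ext i j
  fin_cases i <;> fin_cases j <;>
    first | rfl | exact (hA _ _ (by decide)).symm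

theorem heisenbergMk_lie (x y : ℝ × ℝ × ℝ) :
    ⁅heisenbergMk x, heisenbergMk y⁆ = heisenbergMk (0, 0, x.1 * y.2.1 - y.1 * x.2.1) := by
  refine Subtype.ext ?_
  rw [LieSubalgebra.coe_bracket, Ring.lie_def]
  ext i j
  fin_cases i <;> fin_cases j <;> simp [heisenbergMk]

theorem heisenberg_lie_lie (A B C : heisenberg) : ⁅A, ⁅B, C⁆⁆ = 0 := by
  obtain ⟨x, rfl⟩ := heisenbergMk_surjective A
  obtain ⟨y, rfl⟩ := heisenbergMk_surjective B
  obtain ⟨z, rfl⟩ := heisenbergMk_surjective C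
  rw [heisenbergMk_lie, heisenbergMk_lie]
  simp only [mul_zero, zero_mul, sub_zero]
  exact map_zero heisenbergMk

theorem heisenberg_not_abelian : ∃ A B : heisenberg, ⁅A, B⁆ ≠ 0 := by
  refine ⟨heisenbergMk (1, 0, 0), heisenbergMk (0, 1, 0), fun h => ?_⟩
  rw [heisenbergMk_lie] at h
  have := congrFun (congrFun (congrArg Subtype.val h) 0) 2
  simp [heisenbergMk] at this

variable {V g : Type*} [AddCommGroup V] [Module ℝ V] [LieRing g] [LieAlgebra ℝ g]
  {φ : Module.End ℝ V} {D : (V × ℝ) ≃ₗ[ℝ] g}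

theorem IsSplit.surjectsOntoHeisenberg (hD : IsSplit φ D) {β γ : V →ₗ[ℝ] ℝ} (hβ0 : β ≠ 0)
    (hβ : ∀ x, β (φ x) = 0) (hγ : ∀ x, γ (φ x) = β x) : SurjectsOntoHeisenberg g := by
  let q : g →ₗ[ℝ] heisenberg := heisenbergMk ∘ₗ
    ((LinearMap.snd ℝ V ℝ).prod ((β ∘ₗ LinearMap.fst ℝ V ℝ).prod (γ ∘ₗ LinearMap.fst ℝ V ℝ))) ∘ₗ
      D.symm.toLinearMap
  have hq : ∀ v t, q (D (v, t)) = heisenbergMk (t, β v, γ v) := by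
    intro v t; simp [q]
  refine ⟨{ q with map_lie' := ?_ }, ?_⟩
  · intro x y
    obtain ⟨⟨v, t⟩, rfl⟩ := D.surjective x
    obtain ⟨⟨w, s⟩, rfl⟩ := D.surjective y
    change q _ = ⁅q _, q _⁆
    rw [hD, hq, hq, hq, heisenbergMk_lie]
    simp [hβ, hγ]
  · change Function.Surjective q
    intro A
    obtain ⟨⟨t, b, c⟩, rfl⟩ := heisenbergMk_surjective A
    obtain ⟨v, hv⟩ : ∃ v, β v = 1 := by
      obtain ⟨v, hv⟩ := DFunLike.ne_iff.mp hβ0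
      exact ⟨(β v)⁻¹ • v, by rw [map_smul, smul_eq_mul]; exact inv_mul_cancel₀ hv⟩
    -- Since `β (φ v) = 0` and `γ (φ v) = β v = 1`, adding multiples of `φ v` corrects `γ` without
    -- changing `β`.
    refine ⟨D (b • v + (c - b * γ v) • φ v, t), ?_⟩
    rw [hq]
    simp [hβ, hγ, hv]

/-- Double brackets vanish in the Heisenberg algebra. If `im φ² = im φ`, every bracket of `g` is a
double bracket `[X, [X, u]]`, so the image would be abelian. -/
theorem IsSplit.range_lt_of_surjectsOntoHeisenberg (hD : IsSplit φ D)
    (h : SurjectsOntoHeisenberg g) : LinearMap.range (φ ^ 2) < LinearMap.range φ := by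
  obtain ⟨p, hp⟩ := h
  have hle : LinearMap.range (φ ^ 2) ≤ LinearMap.range φ := by
    rintro _ ⟨x, rfl⟩
    exact ⟨φ x, by rw [pow_two]; rfl⟩
  refine lt_of_le_of_ne hle fun heq => ?_
  have hp0 : ∀ w, p (D (φ w, 0)) = 0 := by
    intro w
    have : φ w ∈ LinearMap.range (φ ^ 2) := by rw [heq]; exact ⟨w, rfl⟩
    obtain ⟨u, hu⟩ := this
    have h1 : D (φ w, 0) = ⁅D (0, 1), ⁅D (0, 1), D (u, 0)⁆⁆ := by
      rw [hD, hD, ← hu]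
      simp [pow_two]
    rw [h1, LieHom.map_lie, LieHom.map_lie, heisenberg_lie_lie]
  obtain ⟨A, B, hAB⟩ := heisenberg_not_abelian
  obtain ⟨x, rfl⟩ := hp A
  obtain ⟨y, rfl⟩ := hp B
  obtain ⟨⟨v, t⟩, rfl⟩ := D.surjective x
  obtain ⟨⟨w, s⟩, rfl⟩ := D.surjective y
  refine hAB ?_
  rw [← LieHom.map_lie, hD]
  have h2 := hp0 (t • w - s • v)
  rwa [map_sub, map_smul, map_smul] at h2

end Heisenberg

/-! ### The adjoint action on functionals, and the functions `q³ / (aq² + t²)`. -/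

section ExpAd

variable {g : Type*} [LieRing g] [LieAlgebra ℝ g] [FiniteDimensional ℝ g] [TopologicalSpace g]
  [IsTopologicalAddGroup g] [ContinuousSMul ℝ g] [T2Space g]

omit [T2Space g] in
-- The series converges, as coordinates turn it into an operator exponential; the `tsum` in `expAd`
-- is therefore not the default value.
theorem hasSum_expAd (X Y : g) :
    HasSum (fun k : ℕ => ((k.factorial : ℝ)⁻¹) • ((LieAlgebra.ad ℝ g X) ^ k) Y) (expAd X Y) := by
  let L : g ≃ₗ[ℝ] (Fin (Module.finrank ℝ g) → ℝ) := (Module.finBasis ℝ g).equivFun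
  let T : (Fin (Module.finrank ℝ g) → ℝ) →L[ℝ] (Fin (Module.finrank ℝ g) → ℝ) :=
    LinearMap.toContinuousLinearMap
      (L.toLinearMap ∘ₗ (LieAlgebra.ad ℝ g X : g →ₗ[ℝ] g) ∘ₗ L.symm.toLinearMap)
  have hT : ∀ k : ℕ, (T ^ k) (L Y) = L ((LieAlgebra.ad ℝ g X ^ k) Y) := by
    intro k
    induction k with
    | zero => rfl
    | succ k ih =>
      rw [pow_succ', pow_succ', Module.End.mul_apply, mul_apply_eq_comp, ih]
      simp [T]
  have h := (hasSum_exp_apply T (L Y)).mapL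
    (LinearMap.toContinuousLinearMap L.symm.toLinearMap)
  simp only [hT, map_smul, LinearMap.coe_toContinuousLinearMap', LinearEquiv.coe_coe,
    LinearEquiv.symm_apply_apply] at h
  exact h.summable.hasSum

theorem apply_expAd {μ : g →ₗ[ℝ] ℝ} (hμ : ∀ X Y : g, μ ⁅X, Y⁆ = 0) (X Y : g) :
    μ (expAd X Y) = μ Y := by
  have h1 := (hasSum_expAd X Y).mapL (LinearMap.toContinuousLinearMap μ)
  have h2 := hasSum_single (f := fun k : ℕ =>
    (LinearMap.toContinuousLinearMap μ)
      (((k.factorial : ℝ)⁻¹) • ((LieAlgebra.ad ℝ g X) ^ k) Y)) 0 (by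
    intro k hk
    obtain ⟨k, rfl⟩ := Nat.exists_eq_succ_of_ne_zero hk
    rw [map_smul, pow_succ', Module.End.mul_apply, LieAlgebra.ad_apply]
    simp [hμ])
  simpa using h1.unique h2

end ExpAd

/-- A continuous function on the plane which is linear on every line through the origin. -/
noncomputable def conicForm (a t q : ℝ) : ℝ := q ^ 3 / (a * q ^ 2 + t ^ 2)

theorem conicForm_mul (a r t q : ℝ) : conicForm a (r * t) (r * q) = r * conicForm a t q := by
  unfold conicForm
  rcases eq_or_ne r 0 with rfl | hr
  · simp
  · rw [show (r * q) ^ 3 = r ^ 2 * (r * q ^ 3) by ring,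
      show a * (r * q) ^ 2 + (r * t) ^ 2 = r ^ 2 * (a * q ^ 2 + t ^ 2) by ring,
      mul_div_mul_left _ _ (pow_ne_zero 2 hr), mul_div_assoc]

/-- The hypothesis says that `(t, q)` and `(s, r)` are collinear, and on a line homogeneity is
linearity. -/
theorem conicForm_add (a : ℝ) {t q s r : ℝ} (h : t * r = s * q) (x y : ℝ) :
    conicForm a (x * t + y * s) (x * q + y * r) =
      x * conicForm a t q + y * conicForm a s r := by
  have key : ∀ z, s = z * t → r = z * q → conicForm a (x * t + y * s) (x * q + y * r) =
      x * conicForm a t q + y * conicForm a s r := by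
    rintro z rfl rfl
    rw [conicForm_mul, show x * t + y * (z * t) = (x + y * z) * t by ring,
      show x * q + y * (z * q) = (x + y * z) * q by ring, conicForm_mul]
    ring
  by_cases ht : t = 0
  · by_cases hq : q = 0
    · subst ht hq
      have h0 : conicForm a 0 0 = 0 := by simp [conicForm]
      rw [h0]
      simp [conicForm_mul]
    · subst ht
      have hs : s = 0 := by
        rcases mul_eq_zero.mp (show s * q = 0 by rw [← h, zero_mul]) with h | h
        · exact h
        · exact absurd h hq
      exact key (r / q) (by simp [hs]) (by field_simp)
  · exact key (s / t) (by field_simp) (by field_simp; linarith)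

theorem continuous_conicForm {a : ℝ} (ha : 0 < a) :
    Continuous fun p : ℝ × ℝ => conicForm a p.1 p.2 := by
  rw [continuous_iff_continuousAt]
  rintro ⟨t, q⟩
  by_cases h : a * q ^ 2 + t ^ 2 = 0
  · have hq : q = 0 := by
      by_contra hq
      have : 0 < a * q ^ 2 := by positivity
      nlinarith [sq_nonneg t]
    subst hq
    have ht : t = 0 := by simpa using h
    subst ht
    -- The convention `0 / 0 = 0` gives the value required for continuity at the origin.
    have h0 : conicForm a 0 0 = 0 := by simp [conicForm]
    rw [ContinuousAt, h0]
    have hb : ∀ p : ℝ × ℝ, ‖conicForm a p.1 p.2‖ ≤ |p.2| / a := by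
      rintro ⟨t, q⟩
      simp only [conicForm, Real.norm_eq_abs, abs_div, abs_pow]
      have hnn : 0 ≤ a * q ^ 2 + t ^ 2 := by positivity
      rw [abs_of_nonneg hnn]
      rcases hnn.eq_or_lt with h0 | hpos
      · rw [← h0, div_zero]; positivity
      · rw [div_le_div_iff₀ hpos ha, pow_succ, sq_abs]
        nlinarith [abs_nonneg q, mul_nonneg (abs_nonneg q) (sq_nonneg t)]
    refine squeeze_zero_norm hb ?_
    have : Continuous fun p : ℝ × ℝ => |p.2| / a := by fun_prop
    simpa using this.tendsto (0, 0)
  · unfold conicForm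
    exact ContinuousAt.div (by fun_prop) (by fun_prop) h

/-- Clearing denominators gives a polynomial that vanishes on `[0, ∞)`, hence is zero. At `-a₀` only
the term of `a₀` remains, with a nonzero product as factor. -/
theorem linearIndependent_inv_add (s : Finset ℝ) (c : ℝ → ℝ)
    (hs : ∀ a ∈ s, 0 < a) (h : ∀ y : ℝ, 0 ≤ y → ∑ a ∈ s, c a * (a + y)⁻¹ = 0) :
    ∀ a ∈ s, c a = 0 := by
  classical
  intro a₀ ha₀
  let P : Polynomial ℝ := ∑ a ∈ s, Polynomial.C (c a) * ∏ b ∈ s.erase a,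
    (Polynomial.C b + Polynomial.X)
  have hP : ∀ y, P.eval y = ∑ a ∈ s, c a * ∏ b ∈ s.erase a, (b + y) := by
    intro y
    simp [P, Polynomial.eval_finsetSum, Polynomial.eval_prod]
  have hP0 : P = 0 := by
    refine Polynomial.eq_zero_of_infinite_isRoot P ((Set.Ici_infinite (0 : ℝ)).mono ?_)
    intro y hy
    change P.eval y = 0
    have hpos : ∀ a ∈ s, a + y ≠ 0 := fun a ha => (add_pos_of_pos_of_nonneg (hs a ha) hy).ne'
    calc P.eval y = (∏ b ∈ s, (b + y)) * ∑ a ∈ s, c a * (a + y)⁻¹ := by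
          rw [hP, Finset.mul_sum]
          refine Finset.sum_congr rfl fun a ha => ?_
          rw [← Finset.mul_prod_erase s _ ha]
          have := hpos a ha
          field_simp
      _ = 0 := by rw [h y hy, mul_zero]
  have h1 := hP (-a₀)
  rw [hP0, Polynomial.eval_zero, Finset.sum_eq_single a₀] at h1
  · rcases mul_eq_zero.mp h1.symm with h2 | h2
    · exact h2
    · obtain ⟨b, hb, hb0⟩ := Finset.prod_eq_zero_iff.mp h2
      exact absurd (by linarith) (Finset.ne_of_mem_erase hb)
  · intro a _ haa
    rw [Finset.prod_eq_zero (Finset.mem_erase.mpr ⟨haa.symm, ha₀⟩) (by simp), mul_zero]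
  · exact fun h => absurd ha₀ h

/-! ### Uncountably many quasi-states, and failure of rigidity. -/

namespace IsSplit

variable {V g : Type*} [AddCommGroup V] [Module ℝ V] [LieRing g] [LieAlgebra ℝ g]
  [FiniteDimensional ℝ g] [TopologicalSpace g]
  [IsTopologicalAddGroup g] [ContinuousSMul ℝ g] [T2Space g]
  {φ : Module.End ℝ V} {D : (V × ℝ) ≃ₗ[ℝ] g}

theorem conicForm_mem (hD : IsSplit φ D) {β γ : V →ₗ[ℝ] ℝ}
    (hβ : ∀ x, β (φ x) = 0) (hγ : ∀ x, γ (φ x) = β x) {a : ℝ} (ha : 0 < a) :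
    (fun Y => conicForm a (D.symm Y).2 (β (D.symm Y).1)) ∈ contAdQuasiStates g := by
  let lt : g →ₗ[ℝ] ℝ := LinearMap.snd ℝ V ℝ ∘ₗ D.symm.toLinearMap
  let lq : g →ₗ[ℝ] ℝ := β ∘ₗ LinearMap.fst ℝ V ℝ ∘ₗ D.symm.toLinearMap
  have ht : ∀ X Y : g, lt ⁅X, Y⁆ = 0 := by
    intro X Y
    obtain ⟨⟨v, t⟩, rfl⟩ := D.surjective X
    obtain ⟨⟨w, s⟩, rfl⟩ := D.surjective Y
    rw [hD]; simp [lt]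
  have hq : ∀ X Y : g, lq ⁅X, Y⁆ = 0 := by
    intro X Y
    obtain ⟨⟨v, t⟩, rfl⟩ := D.surjective X
    obtain ⟨⟨w, s⟩, rfl⟩ := D.surjective Y
    rw [hD]; simp [lq, hβ]
  change (fun Y => conicForm a (lt Y) (lq Y)) ∈ contAdQuasiStates g
  refine ⟨fun x y X Y hXY => ?_, ?_, fun X Y => ?_⟩
  · simp only [map_add, map_smul, smul_eq_mul]
    refine conicForm_add a ?_ x y
    obtain ⟨⟨v, t⟩, rfl⟩ := D.surjective X
    obtain ⟨⟨w, s⟩, rfl⟩ := D.surjective Y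
    rw [hD, LinearEquiv.map_eq_zero_iff, Prod.mk_eq_zero] at hXY
    have h1 := congrArg γ hXY.1
    simp only [map_sub, map_smul, hγ, smul_eq_mul, map_zero] at h1
    simp only [lt, lq, LinearMap.comp_apply, LinearEquiv.coe_coe, LinearEquiv.symm_apply_apply,
      LinearMap.fst_apply, LinearMap.snd_apply]
    linarith
  · exact (continuous_conicForm ha).comp
      ((LinearMap.continuous_of_finiteDimensional lt).prodMk
        (LinearMap.continuous_of_finiteDimensional lq))
  · simp only [apply_expAd ht, apply_expAd hq]

theorem aleph0_lt_rank (hD : IsSplit φ D) {β γ : V →ₗ[ℝ] ℝ} (hβ0 : ∃ v, β v = 1)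
    (hβ : ∀ x, β (φ x) = 0) (hγ : ∀ x, γ (φ x) = β x) :
    Cardinal.aleph0 < Module.rank ℝ (contAdQuasiStates g) := by
  obtain ⟨v, hv⟩ := hβ0
  let F : Set.Ioi (0 : ℝ) → contAdQuasiStates g := fun a => ⟨_, hD.conicForm_mem hβ hγ a.2⟩
  have hF : LinearIndependent ℝ F := by
    classical
    rw [linearIndependent_iff']
    intro s c hc a ha
    let c' : ℝ → ℝ := fun x => if hx : 0 < x then c ⟨x, hx⟩ else 0
    have hc' : ∀ a : Set.Ioi (0 : ℝ), c' a = c a := fun a => dif_pos a.2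
    rw [← hc']
    refine linearIndependent_inv_add (s.map (Function.Embedding.subtype _)) c' ?_ ?_ a
      (Finset.mem_map_of_mem _ ha)
    · intro x hx
      obtain ⟨y, -, rfl⟩ := Finset.mem_map.mp hx
      exact y.2
    · intro y hy
      -- At `q = 1` and `t = √y` the functions become `1 / (a + y)`.
      have h1 := congrFun (congrArg Subtype.val hc) (D (v, Real.sqrt y))
      rw [AddSubmonoidClass.coe_finsetSum, Finset.sum_apply] at h1
      rw [Finset.sum_map]
      refine Eq.trans (Finset.sum_congr rfl fun a _ => ?_) h1
      change c' a * ((a : ℝ) + y)⁻¹ = c a * conicForm a (D.symm (D (v, Real.sqrt y))).2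
        (β (D.symm (D (v, Real.sqrt y))).1)
      rw [hc', LinearEquiv.symm_apply_apply, conicForm, hv, Real.sq_sqrt hy]
      simp
  have h1 := hF.cardinal_lift_le_rank
  rw [Cardinal.mk_Ioi_real, Cardinal.lift_continuum] at h1
  have h2 := Cardinal.aleph0_lt_continuum.trans_le h1
  simpa using h2

theorem not_isRigid (hD : IsSplit φ D) {β γ : V →ₗ[ℝ] ℝ} (hβ0 : ∃ v, β v = 1)
    (hβ : ∀ x, β (φ x) = 0) (hγ : ∀ x, γ (φ x) = β x) : ¬ IsRigid g := by
  intro hr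
  obtain ⟨v, hv⟩ := hβ0
  have hmem : (fun Y => conicForm 1 (D.symm Y).2 (β (D.symm Y).1)) ∈ qmQuasiStates g := by
    rw [hr]
    exact hD.conicForm_mem hβ hγ one_pos
  have had : ∀ (u : V) (k : ℕ), (LieAlgebra.ad ℝ g (D (u, 1)) ^ k) (D (v, 0)) =
      D ((φ ^ k) v, 0) := by
    intro u k
    induction k with
    | zero => rfl
    | succ k ih =>
      rw [pow_succ', Module.End.mul_apply, ih, LieAlgebra.ad_apply, hD, pow_succ',
        Module.End.mul_apply]
      simp
  -- The identity would read `8/5 + 0 = 1/2 + 1/2`.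
  have h := affine_of_mem_qm hmem (X := D (0, 1)) (v := D (v, 0)) (w := D (v, 0)) (by
    intro k
    rw [← map_add, Prod.mk_add_mk, add_zero, had, had])
  simp [← map_add, conicForm, hv] at h
  rw [LinearMap.map_add, hv] at h
  norm_num at h

end IsSplit
-- Linearity and rigidity when `im φ² = im φ`.
namespace IsSplit

open Filter
open scoped Topology

variable {V g : Type*} [AddCommGroup V] [Module ℝ V] [LieRing g] [LieAlgebra ℝ g]
  [FiniteDimensional ℝ g] [TopologicalSpace g]
  [IsTopologicalAddGroup g] [ContinuousSMul ℝ g] [T2Space g]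
  {φ : Module.End ℝ V} {D : (V × ℝ) ≃ₗ[ℝ] g}

omit [FiniteDimensional ℝ g] [IsTopologicalAddGroup g] [ContinuousSMul ℝ g] [T2Space g] in
-- As `V` is an abelian ideal, `(ad u)² = 0` and the series stops after the linear term.
theorem expAd_apply (hD : IsSplit φ D) (u v : V) (t : ℝ) :
    expAd (D (u, 0)) (D (v, t)) = D (v - t • φ u, t) := by
  have h1 : ∀ w s, ⁅D (u, 0), D (w, s)⁆ = D (-(s • φ u), 0) := by
    intro w s
    rw [hD]
    simp
  have h2 : ∀ k : ℕ, (LieAlgebra.ad ℝ g (D (u, 0)) ^ (k + 2)) (D (v, t)) = 0 := by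
    intro k
    rw [pow_add, Module.End.mul_apply, pow_two, Module.End.mul_apply, LieAlgebra.ad_apply,
      LieAlgebra.ad_apply, h1, h1, zero_smul, neg_zero, Prod.mk_zero_zero, map_zero, map_zero]
  rw [expAd, tsum_eq_sum (s := Finset.range 2)]
  · simp only [Finset.sum_range_succ, Finset.sum_range_zero, Nat.factorial, Nat.cast_one, inv_one,
      one_smul, pow_zero, pow_one, Module.End.one_apply, LieAlgebra.ad_apply, h1, ← map_add,
      zero_add, mul_one]
    simp [sub_eq_add_neg]
  · intro k hk
    obtain ⟨j, rfl⟩ : ∃ j, k = j + 2 := ⟨k - 2, by simp at hk; omega⟩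
    rw [h2, smul_zero]

omit [FiniteDimensional ℝ g] [T2Space g] in
/-- If `im φ² = im φ`, the continuous `Ad`-invariant Lie quasi-states are linear. -/
theorem exists_linear (hD : IsSplit φ D)
    (hφ : ¬ LinearMap.range (φ ^ 2) < LinearMap.range φ) {ζ : g → ℝ}
    (hζ : ζ ∈ contAdQuasiStates g) :
    ∃ (ℓ : V →ₗ[ℝ] ℝ) (c : ℝ), (∀ v, ℓ (φ v) = 0) ∧ ∀ v t, ζ (D (v, t)) = ℓ v + c * t := by
  obtain ⟨hq, hc, hA⟩ := hζ
  have hle : LinearMap.range (φ ^ 2) ≤ LinearMap.range φ := by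
    rintro _ ⟨x, rfl⟩
    exact ⟨φ x, by rw [pow_two]; rfl⟩
  have heq : LinearMap.range φ ≤ LinearMap.range (φ ^ 2) := by
    by_contra h
    exact hφ (lt_of_le_not_ge hle h)
  have h00 : ζ 0 = 0 := by simpa using hq 0 0 0 0 (by simp)
  have hsub : ∀ (a b : ℝ) (v w : V), ζ (D (a • v + b • w, 0)) = a * ζ (D (v, 0)) + b * ζ (D (w, 0)) := by
    intro a b v w
    rw [← hq a b _ _ (by rw [hD]; simp), ← map_smul, ← map_smul, ← map_add]
    simp
  let ℓ : V →ₗ[ℝ] ℝ :=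
    { toFun := fun v => ζ (D (v, 0))
      map_add' := fun v w => by simpa using hsub 1 1 v w
      map_smul' := fun a v => by simpa using hsub a 0 v v }
  have hshift : ∀ (u v : V) (t : ℝ), t ≠ 0 → ζ (D (v - φ u, t)) = ζ (D (v, t)) := by
    intro u v t ht
    have := hA (D (t⁻¹ • u, 0)) (D (v, t))
    rwa [hD.expAd_apply, map_smul, smul_inv_smul₀ ht] at this
  have hcont : ∀ v : V, Tendsto (fun t : ℝ => ζ (D (v, t))) (𝓝[≠] 0) (𝓝 (ζ (D (v, 0)))) := by
    intro v
    have h1 : ∀ t : ℝ, D (v, t) = D (v, 0) + t • D (0, 1) := by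
      intro t
      rw [← map_smul, ← map_add]
      simp
    have h2 : Continuous fun t : ℝ => ζ (D (v, t)) := by
      rw [show (fun t : ℝ => ζ (D (v, t))) = fun t => ζ (D (v, 0) + t • D (0, 1)) from
        funext fun t => congrArg ζ (h1 t)]
      exact hc.comp (continuous_const.add (continuous_id.smul continuous_const))
    exact (h2.tendsto 0).mono_left nhdsWithin_le_nhds
  -- For `t ≠ 0` the values at `φ v + tX` and at `tX` agree; let `t → 0`.
  have hℓ : ∀ v, ℓ (φ v) = 0 := by
    intro v
    have h1 := hcont (φ v - φ v)
    have h2 := hcont (φ v)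
    have h3 := tendsto_nhds_unique (h1.congr' (by
      filter_upwards [self_mem_nhdsWithin] with t ht
      exact hshift v (φ v) t ht)) h2
    change ζ (D (φ v, 0)) = 0
    rw [← h3, sub_self, Prod.mk_zero_zero, map_zero, h00]
  refine ⟨ℓ, ζ (D (0, 1)), hℓ, fun v t => ?_⟩
  rcases eq_or_ne t 0 with rfl | ht
  · simp [ℓ]
  -- With `φ v = φ² u`, the vector `v - φ u` commutes with `X`, and replacing `v` by it changes
  -- neither `ζ` nor `ℓ`.
  · obtain ⟨u, hu⟩ := heq ⟨v, rfl⟩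
    have hk : φ (v - φ u) = 0 := by
      rw [map_sub, ← hu, pow_two]
      exact sub_self _
    rw [← hshift u v t ht]
    have h1 := hq 1 t (D (v - φ u, 0)) (D (0, 1)) (by rw [hD, hk]; simp)
    rw [← map_smul, ← map_smul, ← map_add] at h1
    have h2 : ℓ (v - φ u) = ℓ v := by rw [map_sub, hℓ, sub_zero]
    rw [← h2]
    simpa [ℓ, mul_comm] using h1

theorem finite_contAdQuasiStates (hD : IsSplit φ D)
    (hφ : ¬ LinearMap.range (φ ^ 2) < LinearMap.range φ) :
    Module.Finite ℝ (contAdQuasiStates g) := by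
  let ι : (g →ₗ[ℝ] ℝ) →ₗ[ℝ] (g → ℝ) :=
    { toFun := fun f => f
      map_add' := fun _ _ => rfl
      map_smul' := fun _ _ => rfl }
  have hle : contAdQuasiStates g ≤ LinearMap.range ι := by
    intro ζ hζ
    obtain ⟨ℓ, c, -, h⟩ := hD.exists_linear hφ hζ
    refine ⟨(ℓ.coprod (c • LinearMap.id)) ∘ₗ D.symm.toLinearMap, ?_⟩
    ext Y
    obtain ⟨⟨v, t⟩, rfl⟩ := D.surjective Y
    rw [h]
    simp [ι]
  have : FiniteDimensional ℝ (LinearMap.range ι) := inferInstance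
  exact Submodule.finiteDimensional_of_le hle

theorem mem_qmQuasiStates [FiniteDimensional ℝ V] (hD : IsSplit φ D)
    (hφ : ¬ LinearMap.range (φ ^ 2) < LinearMap.range φ) {ζ : g → ℝ}
    (hζ : ζ ∈ contAdQuasiStates g) : ζ ∈ qmQuasiStates g := by
  obtain ⟨ℓ, c, hℓ, h⟩ := hD.exists_linear hφ hζ
  -- Coordinates are needed because `qmQuasiStates` asks for a group in `Type`, whereas `V` lives in
  -- an arbitrary universe.
  let B : V ≃ₗ[ℝ] (Fin (Module.finrank ℝ V) → ℝ) := (Module.finBasis ℝ V).equivFun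
  let T : (Fin (Module.finrank ℝ V) → ℝ) →L[ℝ] (Fin (Module.finrank ℝ V) → ℝ) :=
    LinearMap.toContinuousLinearMap (B.toLinearMap ∘ₗ φ ∘ₗ B.symm.toLinearMap)
  let m : (Fin (Module.finrank ℝ V) → ℝ) →L[ℝ] ℝ :=
    LinearMap.toContinuousLinearMap (ℓ ∘ₗ B.symm.toLinearMap)
  have hT : ∀ v, T (B v) = B (φ v) := by intro v; simp [T]
  have hmB : ∀ v, m (B v) = ℓ v := by intro v; simp [m]
  have hm : ∀ w, m (T w) = 0 := by
    intro w
    obtain ⟨v, rfl⟩ := B.surjective w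
    rw [hT, hmB, hℓ]
  let L : g ≃ₗ[ℝ] ((Fin (Module.finrank ℝ V) → ℝ) × ℝ) :=
    D.symm.trans (B.prodCongr (LinearEquiv.refl ℝ ℝ))
  have hL : ∀ v t, L (D (v, t)) = (B v, t) := by intro v t; simp [L]
  have hbr : ∀ X Y : g, L ⁅X, Y⁆ = groupBracket (FlowGroup T) (L X) (L Y) := by
    intro X Y
    obtain ⟨⟨v, t⟩, rfl⟩ := D.surjective X
    obtain ⟨⟨w, s⟩, rfl⟩ := D.surjective Y
    rw [FlowGroup.groupBracket_eq, hD, hL, hL, hL, hT, hT]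
    simp
  let e : g ≃ₗ⁅ℝ⁆ GroupLieAlgebra 𝓘(ℝ, (Fin (Module.finrank ℝ V) → ℝ) × ℝ) (FlowGroup T) :=
    { (L : g ≃ₗ[ℝ] GroupLieAlgebra 𝓘(ℝ, (Fin (Module.finrank ℝ V) → ℝ) × ℝ) (FlowGroup T)) with
      map_lie' := fun {X Y} => hbr X Y }
  refine ⟨hζ.1, hζ.2.1, (Fin (Module.finrank ℝ V) → ℝ) × ℝ, inferInstance, inferInstance,
    inferInstance, FlowGroup T, inferInstance, inferInstance, inferInstance, inferInstance,
    inferInstance, inferInstance, e, fun p => m p.1 + c * p.2,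
    isHomogeneousQuasimorphism_flowGroup T hm c, fun Y => ?_⟩
  refine ⟨FlowGroup.oneParam T (L Y) 1, ⟨FlowGroup.oneParam T (L Y),
    (FlowGroup.isOneParam_oneParam T (L Y)).zero,
    (FlowGroup.isOneParam_oneParam T (L Y)).logDeriv, rfl⟩, ?_⟩
  obtain ⟨⟨v, t⟩, rfl⟩ := D.surjective Y
  have h1 := apply_oneParam T hm (L (D (v, t)))
  have h2 : (FlowGroup.oneParam T (L (D (v, t))) 1).2 = 1 * (L (D (v, t))).2 := rfl
  rw [h]
  exact (congrArg₂ (fun x y => x + c * y) (h1.trans (by rw [hL, hmB]))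
    (h2.trans (by rw [hL, one_mul]))).symm

theorem isRigid [FiniteDimensional ℝ V] (hD : IsSplit φ D)
    (hφ : ¬ LinearMap.range (φ ^ 2) < LinearMap.range φ) : IsRigid g := by
  refine Set.Subset.antisymm (fun ζ hζ => ?_) fun ζ hζ => hD.mem_qmQuasiStates hφ hζ
  exact ⟨hζ.1, hζ.2.1, isAdInvariant_of_mem_qm hζ⟩

end IsSplit

/-! ### The splitting of `g` and the equivalences. -/

theorem exists_isSplit {g : Type*} [LieRing g] [LieAlgebra ℝ g]
    (V : LieIdeal ℝ g) (hV : ∀ v w : g, v ∈ V → w ∈ V → ⁅v, w⁆ = 0)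
    (X : g) (hX : X ≠ 0) (hVX : IsCompl V.toSubmodule (Submodule.span ℝ {X}))
    (φ : Module.End ℝ V) (hφ : ∀ v : V, ((φ v : V) : g) = ⁅X, (v : g)⁆) :
    ∃ D : (V × ℝ) ≃ₗ[ℝ] g, IsSplit φ D := by
  let D : (V × ℝ) ≃ₗ[ℝ] g :=
    ((LinearEquiv.refl ℝ V).prodCongr (LinearEquiv.toSpanNonzeroSingleton ℝ g X hX)).trans
      (Submodule.prodEquivOfIsCompl V.toSubmodule (Submodule.span ℝ {X}) hVX)
  have hDa : ∀ (v : V) (t : ℝ), D (v, t) = (v : g) + t • X := by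
    intro v t
    exact Submodule.coe_prodEquivOfIsCompl' _ _ hVX _
  refine ⟨D, fun v w t s => ?_⟩
  rw [hDa, hDa, hDa]
  have h1 : ⁅(v : g), X⁆ = -⁅X, (v : g)⁆ := (lie_skew _ _).symm
  simp only [lie_add, add_lie, lie_smul, smul_lie, hV v w v.2 w.2, lie_self, h1]
  push_cast
  rw [hφ, hφ]
  simp only [smul_neg, smul_zero, add_zero, zero_add, zero_smul]
  abel

end QuasiState

theorem mainTheorem3 {g : Type*} [LieRing g] [LieAlgebra ℝ g] [Module.Finite ℝ g]
    [TopologicalSpace g] [IsTopologicalAddGroup g] [ContinuousSMul ℝ g] [T2Space g]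
    (V : LieIdeal ℝ g) (hV : ∀ v w : g, v ∈ V → w ∈ V → ⁅v, w⁆ = 0)
    (X : g) (hX : X ≠ 0) (hVX : IsCompl V.toSubmodule (Submodule.span ℝ {X}))
    (φ : Module.End ℝ V) (hφ : ∀ v : V, ((φ v : V) : g) = ⁅X, (v : g)⁆) :
    (QuasiState.IsRigid g ↔ ¬ QuasiState.SurjectsOntoHeisenberg g) ∧
    List.TFAE [
      ¬ QuasiState.IsRigid g,
      ¬ Module.Finite ℝ (QuasiState.contAdQuasiStates g),
      Cardinal.aleph0 < Module.rank ℝ (QuasiState.contAdQuasiStates g),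
      LinearMap.range (φ ^ 2) < LinearMap.range φ,
      QuasiState.HasNilpotentJordanBlock φ,
      QuasiState.SurjectsOntoHeisenberg g] := by
  obtain ⟨D, hD⟩ := QuasiState.exists_isSplit V hV X hX hVX φ hφ
  have hfun : QuasiState.HasNilpotentJordanBlock φ → ∃ β γ : V →ₗ[ℝ] ℝ, (∃ v, β v = 1) ∧ β ≠ 0 ∧
      (∀ x, β (φ x) = 0) ∧ ∀ x, γ (φ x) = β x := by
    intro h
    obtain ⟨β, γ, hβ0, hβ, hγ⟩ := QuasiState.exists_functionals_of_hasNilpotentJordanBlock h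
    obtain ⟨v, hv⟩ := DFunLike.ne_iff.mp hβ0
    exact ⟨β, γ, ⟨(β v)⁻¹ • v, by rw [map_smul, smul_eq_mul]; exact inv_mul_cancel₀ hv⟩,
      hβ0, hβ, hγ⟩
  have htfae : List.TFAE [
      ¬ QuasiState.IsRigid g,
      ¬ Module.Finite ℝ (QuasiState.contAdQuasiStates g),
      Cardinal.aleph0 < Module.rank ℝ (QuasiState.contAdQuasiStates g),
      LinearMap.range (φ ^ 2) < LinearMap.range φ,
      QuasiState.HasNilpotentJordanBlock φ,
      QuasiState.SurjectsOntoHeisenberg g] := by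
    tfae_have 1 → 4 := fun h => by
      by_contra h4
      exact h (hD.isRigid h4)
    tfae_have 4 → 5 := fun h => by
      obtain ⟨n, v, α, h1, h2, h3⟩ := QuasiState.exists_cyclic_vector φ h
      exact QuasiState.hasNilpotentJordanBlock_of_cyclic_vector φ (by omega) h1 h2 h3
    tfae_have 5 → 1 := fun h => by
      obtain ⟨β, γ, hv, -, hβ, hγ⟩ := hfun h
      exact hD.not_isRigid hv hβ hγ
    tfae_have 5 → 6 := fun h => by
      obtain ⟨β, γ, -, hβ0, hβ, hγ⟩ := hfun h
      exact hD.surjectsOntoHeisenberg hβ0 hβ hγ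
    tfae_have 6 → 4 := hD.range_lt_of_surjectsOntoHeisenberg
    tfae_have 5 → 3 := fun h => by
      obtain ⟨β, γ, hv, -, hβ, hγ⟩ := hfun h
      exact hD.aleph0_lt_rank hv hβ hγ
    tfae_have 3 → 2 := fun h hf => (Module.rank_lt_aleph0 ℝ _).not_gt h
    tfae_have 2 → 4 := fun h => by
      by_contra h4
      exact h (hD.finite_contAdQuasiStates h4)
    tfae_finish
  exact ⟨not_iff_comm.mp (htfae.out 0 5) |>.symm, htfae⟩
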